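/- Let $p$ be an odd prime, let $\varepsilon$ be an integer that is not a square modulo $p$, and let $M$ be a positive integer prime to $p$. Let $K$ be an imaginary quadratic field in which $p$ is inert, let $f$ be a positive integer prime to $p^2M$, and for $c\ge 1$ let $\mathcal{O}_c=\mathbb{Z}+c\,\mathcal{O}_K$ be the order of conductor $c$ in $K$. Let $B$ be an indefinite quaternion algebra over $\mathbb{Q}$ (that is, $B\otimes\mathbb{R}\simeq M_2(\mathbb{R})$), and let $R\subset B$ be an order of (reduced) discriminant $M$ such that there is an embedding $\iota_0:K\to B$ of $\mathbb{Q}$-algebras with $\iota_0(K)\cap R=\iota_0(\mathcal{O}_f)$. Fix an isomorphism of $\mathbb{Q}_p$-algebras $B_p=B\otimes\mathbb{Q}_p\simeq M_2(\mathbb{Q}_p)$ under which $R_p=R\otimes\mathbb{Z}_p$ corresponds to $M_2(\mathbb{Z}_p)$, and write $x_p\in M_2(\mathbb{Q}_p)$ for the image of $x\in B$. Put \[ M_{ns}=\left\{\begin{pmatrix}a&b\\c&d\end{pmatrix}\in M_2(\mathbb{Z}_p): a\equiv d,\ b\varepsilon\equiv c \bmod p\right\},\qquad M_{s}=\left\{\begin{pmatrix}a&b\\c&d\end{pmatrix}\in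 M_2(\mathbb{Z}_p): b\equiv c\equiv 0 \bmod p\right\}, \] and let $R_{ns}=\{x\in R: x_p\in M_{ns}\}$ and $R_s=\{x\in R: x_p\in M_s\}$ be the corresponding non-split and split Cartan orders. Then there exists an embedding $\iota:K\to B$ of $\mathbb{Q}$-algebras such that 1. $\mathcal{O}_f$ embeds optimally into $R_{ns}$, that is, $\iota(K)\cap R_{ns}=\iota(\mathcal{O}_f)$; 2. with the same $\iota$, $\mathcal{O}_{pf}$ embeds optimally into $R_s$, that is, $\iota(K)\cap R_s=\iota(\mathcal{O}_{pf})$. -/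

import Mathlib

open scoped TensorProduct NumberField

noncomputable section

/-- A subring `R` of a `ℚ`-algebra `B` is an order: it is finitely generated as a `ℤ`-module and
spans `B` over `ℚ`. -/
def IsQuatOrder {B : Type*} [Ring B] [Algebra ℚ B] (R : Subring B) : Prop :=
  R.toAddSubgroup.toIntSubmodule.FG ∧ Submodule.span ℚ (R : Set B) = ⊤

/-- The reduced trace of a quaternion algebra: half of the trace of left multiplication. -/
def quatTrd {B : Type*} [Ring B] [Algebra ℚ B] (x : B) : ℚ :=
  LinearMap.trace ℚ B (LinearMap.mulLeft ℚ x) / 2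

/-- The order `R` of a quaternion algebra over `ℚ` has (reduced) discriminant `M`, that is,
`|det (trd (eᵢ eⱼ))| = M²` for a `ℤ`-basis `e` of `R` (the determinant does not depend on the
basis). -/
def HasDiscriminant {B : Type*} [Ring B] [Algebra ℚ B] (R : Subring B) (M : ℕ) : Prop :=
  ∃ e : Module.Basis (Fin 4) ℤ R,
    |(Matrix.of fun i j => quatTrd ((e i : B) * (e j : B))).det| = (M : ℚ) ^ 2

/-- The order `ℤ + f 𝓞_K` of conductor `f` in the number field `K` (meant for `K` quadratic). -/
def orderOfConductor (K : Type*) [Field K] [NumberField K] (f : ℕ) : Subring K where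
  carrier := {x | ∃ (a : ℤ) (y : 𝓞 K), x = (a : K) + (f : K) * (y : K)}
  zero_mem' := ⟨0, 0, by simp⟩
  one_mem' := ⟨1, 0, by simp⟩
  add_mem' := by
    rintro _ _ ⟨a, y, rfl⟩ ⟨b, z, rfl⟩
    exact ⟨a + b, y + z, by push_cast; ring⟩
  neg_mem' := by
    rintro _ ⟨a, y, rfl⟩
    exact ⟨-a, -y, by push_cast; ring⟩
  mul_mem' := by
    rintro _ _ ⟨a, y, rfl⟩ ⟨b, z, rfl⟩
    exact ⟨a * b, (a : 𝓞 K) * z + (b : 𝓞 K) * y + (f : 𝓞 K) * (y * z), by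
      simp only [map_add, map_mul, map_intCast, map_natCast, Int.cast_mul]; ring⟩

/-- The embedding `ι : K → B` embeds the order `O` of `K` optimally into the order `R` of `B`:
`ι(K) ∩ R = ι(O)`. -/
def IsOptimalEmbedding {K B : Type*} [Field K] [Algebra ℚ K] [Ring B] [Algebra ℚ B]
    (ι : K →ₐ[ℚ] B) (O : Subring K) (R : Subring B) : Prop :=
  Set.range ι ∩ (R : Set B) = ι '' (O : Set K)

/-- The non-split Cartan order `M_ns` of matrices `(a, b; c, d)` over `ℤ_p` with `a ≡ d` and
`b ε ≡ c` modulo `p`. -/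
def nonsplitCartan (p : ℕ) [Fact p.Prime] (ε : ℤ) : Subring (Matrix (Fin 2) (Fin 2) ℤ_[p]) where
  carrier := {A | (p : ℤ_[p]) ∣ A 0 0 - A 1 1 ∧ (p : ℤ_[p]) ∣ A 0 1 * (ε : ℤ_[p]) - A 1 0}
  zero_mem' := by simp
  one_mem' := by simp
  add_mem' := by
    rintro A A' ⟨⟨u, hu⟩, v, hv⟩ ⟨⟨u', hu'⟩, v', hv'⟩
    refine ⟨⟨u + u', ?_⟩, v + v', ?_⟩
    · simp only [Matrix.add_apply]; linear_combination hu + hu'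
    · simp only [Matrix.add_apply]; linear_combination hv + hv'
  neg_mem' := by
    rintro A ⟨⟨u, hu⟩, v, hv⟩
    refine ⟨⟨-u, ?_⟩, -v, ?_⟩
    · simp only [Matrix.neg_apply]; linear_combination -hu
    · simp only [Matrix.neg_apply]; linear_combination -hv
  mul_mem' := by
    rintro A A' ⟨⟨u, hu⟩, v, hv⟩ ⟨⟨u', hu'⟩, v', hv'⟩
    refine ⟨⟨u * A' 0 0 + A 1 1 * u' + v * A' 0 1 - A 0 1 * v', ?_⟩,
      u * A' 0 1 * ε - A 0 1 * ε * u' + v * A' 0 0 + v' * A 1 1 , ?_⟩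
    · simp only [Matrix.mul_apply, Fin.sum_univ_two]
      linear_combination A' 0 0 * hu + A 1 1 * hu' + A' 0 1 * hv - A 0 1 * hv'
    · simp only [Matrix.mul_apply, Fin.sum_univ_two]
      linear_combination A' 0 1 * ε * hu - A 0 1 * ε * hu' + A' 0 0 * hv + A 1 1 * hv'

/-- The split Cartan order `M_s` of matrices `(a, b; c, d)` over `ℤ_p` with `b ≡ c ≡ 0`
modulo `p`. -/
def splitCartan (p : ℕ) [Fact p.Prime] : Subring (Matrix (Fin 2) (Fin 2) ℤ_[p]) where
  carrier := {A | (p : ℤ_[p]) ∣ A 0 1 ∧ (p : ℤ_[p]) ∣ A 1 0}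
  zero_mem' := by simp
  one_mem' := by simp
  add_mem' := by
    rintro A A' ⟨h1, h2⟩ ⟨h1', h2'⟩
    exact ⟨dvd_add h1 h1', dvd_add h2 h2'⟩
  neg_mem' := by
    rintro A ⟨h1, h2⟩
    exact ⟨(dvd_neg).2 h1, (dvd_neg).2 h2⟩
  mul_mem' := by
    rintro A A' ⟨h1, h2⟩ ⟨h1', h2'⟩
    constructor
    · simp only [Matrix.mul_apply, Fin.sum_univ_two]
      exact dvd_add (dvd_mul_of_dvd_right h1' _) (dvd_mul_of_dvd_left h1 _)
    · simp only [Matrix.mul_apply, Fin.sum_univ_two]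
      exact dvd_add (dvd_mul_of_dvd_left h2 _) (dvd_mul_of_dvd_right h2' _)

/-- The inclusion `M₂(ℤ_p) → M₂(ℚ_p)`. -/
def padicMatrixIncl (p : ℕ) [Fact p.Prime] :
    Matrix (Fin 2) (Fin 2) ℤ_[p] →+* Matrix (Fin 2) (Fin 2) ℚ_[p] :=
  (algebraMap ℤ_[p] ℚ_[p]).mapMatrix

/-- The localization `R_p = R ⊗ ℤ_p` of `R`, as the `ℤ_p`-submodule of `B_p = ℚ_p ⊗ B` spanned
by `R`. -/
def localOrder (p : ℕ) [Fact p.Prime] {B : Type*} [Ring B] [Algebra ℚ B] (R : Subring B) :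
    Submodule ℤ_[p] (ℚ_[p] ⊗[ℚ] B) :=
  Submodule.span ℤ_[p] ((fun x : B => (1 : ℚ_[p]) ⊗ₜ[ℚ] x) '' (R : Set B))

/-- Given an identification `φ : B_p ≃ M₂(ℚ_p)`, the map `B → M₂(ℚ_p)`, `x ↦ x_p`. -/
def localComponent {p : ℕ} [Fact p.Prime] {B : Type*} [Ring B] [Algebra ℚ B]
    (φ : ℚ_[p] ⊗[ℚ] B ≃ₐ[ℚ_[p]] Matrix (Fin 2) (Fin 2) ℚ_[p]) :
    B →+* Matrix (Fin 2) (Fin 2) ℚ_[p] :=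
  (φ : ℚ_[p] ⊗[ℚ] B →+* Matrix (Fin 2) (Fin 2) ℚ_[p]).comp
    (Algebra.TensorProduct.includeRight : B →ₐ[ℚ] ℚ_[p] ⊗[ℚ] B).toRingHom

/-- The subring `{x ∈ R : x_p ∈ L}` of `R`, for a subring `L` of `M₂(ℤ_p)`. -/
def levelOrder {p : ℕ} [Fact p.Prime] {B : Type*} [Ring B] [Algebra ℚ B] (R : Subring B)
    (φ : ℚ_[p] ⊗[ℚ] B ≃ₐ[ℚ_[p]] Matrix (Fin 2) (Fin 2) ℚ_[p])
    (L : Subring (Matrix (Fin 2) (Fin 2) ℤ_[p])) : Subring B :=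
  R ⊓ (L.map (padicMatrixIncl p)).comap (localComponent φ)

end

/-! Conjugation by a unit `g` of `R` keeps an embedding optimal for `R`, so only the image of the
order of conductor `f` modulo `p` has to be steered. As `p` is inert and prime to `f`, that image in
`M₂(𝔽_p)` contains a trace-zero element whose square is a nonsquare scalar. It is conjugate under
`SL₂(𝔽_p)` to a multiple of `(0, 1; ε, 0)` (`exists_conj_antidiagonal`), whose commutant is the
non-split Cartan algebra, so after conjugation the whole order lies in `R_ns`. A diagonal matrix in
that algebra is scalar, and the elements of the order with scalar reduction are exactly those of
conductor `p f`, which settles `R_s`.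

Lifting the conjugating matrix to a unit of `R` is strong approximation, proved by hand in
`exists_unit_redMod_eq_of_indefinite`. Take anticommuting `y₀`, `y` in `R` with `y₀² = D₀ < 0`, `y₀
≡ diag(1, -1)` and `y ≡ (0, 2; 2ε, 0)`. Indefiniteness forces `y² = D > 0`, and `D ≡ 4ε` is not a
square. Since `D₀ ≡ 1`, `p` splits in `ℤ[√D₀]`, so `a² - D₀b² = p^m` with `p ∤ a`, and `h = a - b
y₀` reduces to a rank-one diagonal matrix. Then `v = y h^k` has `v² = D p^(mk)`, and a suitable Pell
solution makes `A + c v` a unit reducing to a nontrivial elementary matrix. Changing the sign of `b`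
gives the other triangular shape, and the two generate `SL₂(𝔽_p)`. -/

/-! ### Pell's equation with prescribed `p`-adic valuation. -/

theorem zsqrtd_intCast_mul_sqrtd (D n : ℤ) : ((n : ℤ√D)) * Zsqrtd.sqrtd = ⟨0, n⟩ := by
  ext <;> simp

/-- In Pell's equation, the `p`-adic valuation of the second coordinate can be raised by one. -/
theorem pell_raise_valuation {p : ℕ} [Fact p.Prime] (D : ℤ) {i : ℕ} (hi : 2 ≤ i)
    (h : ∃ A b : ℤ, A ^ 2 - D * (p ^ i * b) ^ 2 = 1 ∧ (p : ℤ) ∣ A - 1 ∧ ¬ (p : ℤ) ∣ b) :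
    ∃ A b : ℤ, A ^ 2 - D * (p ^ (i + 1) * b) ^ 2 = 1 ∧ (p : ℤ) ∣ A - 1 ∧ ¬ (p : ℤ) ∣ b := by
  obtain ⟨A, b, h1, h2, h3⟩ := h
  obtain ⟨j, rfl⟩ := Nat.exists_eq_add_of_le hi
  have hA : ∀ n, (p : ℤ) ∣ A ^ n - 1 := fun n => h2.trans (by simpa using sub_dvd_pow_sub_pow A 1 n)
  set x : ℤ√D := (((p : ℤ) ^ (2 + j) * b : ℤ) : ℤ√D) * Zsqrtd.sqrtd with hx
  -- The `p`-th power of the solution `A + x` is `A^p + p A^(p-1) x + k x²`. The linear term has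
  -- valuation exactly `i + 1`; the remainder has at least `2i ≥ i + 2`.
  obtain ⟨k, hk⟩ := Polynomial.powAddExpansion (A : ℤ√D) x p
  have hx2 : x ^ 2 = (((p : ℤ) ^ (2 * (2 + j)) * b ^ 2 * D : ℤ) : ℤ√D) := by
    rw [hx, mul_pow, pow_two Zsqrtd.sqrtd, Zsqrtd.dmuld]
    push_cast; ring
  set c : ℤ := (p : ℤ) ^ (2 * (2 + j)) * b ^ 2 * D with hc
  have hkx : k * x ^ 2 = ⟨c * k.re, c * k.im⟩ := by
    rw [hx2, mul_comm]; ext <;> simp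
  have hpx : (p : ℤ√D) * (A : ℤ√D) ^ (p - 1) * x
      = ⟨0, (p * A ^ (p - 1) * (p ^ (2 + j) * b) : ℤ)⟩ := by
    have : (p : ℤ√D) * (A : ℤ√D) ^ (p - 1) * x
      = (((p * A ^ (p - 1) * (p ^ (2 + j) * b) : ℤ)) : ℤ√D) * Zsqrtd.sqrtd := by
      rw [hx]; push_cast; ring
    rw [this, zsqrtd_intCast_mul_sqrtd]
  have hAp : (A : ℤ√D) ^ p = ⟨A ^ p, 0⟩ := by
    rw [← Int.cast_pow]; rfl
  rw [hkx, hpx, hAp] at hk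
  have hn : (((A : ℤ√D) + x) ^ p).norm = 1 := by
    have : ((A : ℤ√D) + x).norm = 1 := by
      rw [hx, zsqrtd_intCast_mul_sqrtd]; simp [Zsqrtd.norm_def]; linarith
    have h := map_pow Zsqrtd.normMonoidHom ((A : ℤ√D) + x) p
    change _ = ((A : ℤ√D) + x).norm ^ p at h
    rw [this, one_pow] at h
    exact h
  rw [hk] at hn
  refine ⟨A ^ p + c * k.re, A ^ (p - 1) * b + p ^ (j + 1) * (b ^ 2 * D * k.im), ?_, ?_, ?_⟩
  · simp only [Zsqrtd.norm_def] at hn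
    simp only [Zsqrtd.re_add, Zsqrtd.im_add] at hn
    rw [← hn, hc]; ring
  · have : A ^ p + c * k.re - 1 = (A ^ p - 1) + p * (p ^ (2 * j + 3) * b ^ 2 * D * k.re) := by
      rw [hc]; ring
    rw [this]; exact dvd_add (hA p) (dvd_mul_right _ _)
  · intro h
    have h4 : (p : ℤ) ∣ A ^ (p - 1) * b := by
      rw [pow_succ', mul_assoc] at h
      exact (dvd_add_left (dvd_mul_right _ _)).1 h
    have h5 := dvd_sub h4 ((hA (p - 1)).mul_right b)
    rw [show A ^ (p - 1) * b - (A ^ (p - 1) - 1) * b = b by ring] at h5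
    exact h3 h5

/-- Pell's equation has solutions with second coordinate of any large `p`-adic valuation. -/
theorem exists_pell_valuation {p : ℕ} [Fact p.Prime] {D : ℤ} (hD : 0 < D) (hsq : ¬ IsSquare D) :
    ∃ i₀, ∀ i ≥ i₀, ∃ A b : ℤ,
      A ^ 2 - D * (p ^ i * b) ^ 2 = 1 ∧ (p : ℤ) ∣ A - 1 ∧ ¬ (p : ℤ) ∣ b := by
  have hp0 : (p : ℤ) ≠ 0 := by exact_mod_cast (Fact.out : p.Prime).ne_zero
  have hpp : Prime (p : ℤ) := Nat.prime_iff_prime_int.1 Fact.out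
  -- The factor `p ^ 4` supplies the `p ^ 2` in the second coordinate that starts the induction, and
  -- forces `x² ≡ 1` modulo `p`.
  have hD' : 0 < D * (p : ℤ) ^ 4 := by positivity
  have hsq' : ¬ IsSquare (D * (p : ℤ) ^ 4) := by
    rintro ⟨r, hr⟩
    have h1 : ((p : ℤ) ^ 2) ^ 2 ∣ r ^ 2 := ⟨D, by rw [pow_two r, ← hr]; ring⟩
    obtain ⟨q, rfl⟩ := (Int.pow_dvd_pow_iff two_ne_zero).1 h1
    refine hsq ⟨q, ?_⟩
    have : (p : ℤ) ^ 4 ≠ 0 := pow_ne_zero _ hp0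
    apply mul_right_cancel₀ this
    rw [hr]; ring
  obtain ⟨x, y, hxy, hy⟩ := Pell.exists_of_not_isSquare hD' hsq'
  have hfin : FiniteMultiplicity (p : ℤ) y :=
    Int.finiteMultiplicity_iff.2 ⟨by simpa using (Fact.out : p.Prime).ne_one, hy⟩
  obtain ⟨b, hb, hpb⟩ := hfin.exists_eq_pow_mul_and_not_dvd
  set m := multiplicity (p : ℤ) y
  have base : ∃ A b : ℤ,
      A ^ 2 - D * (p ^ (m + 2) * b) ^ 2 = 1 ∧ (p : ℤ) ∣ A - 1 ∧ ¬ (p : ℤ) ∣ b := by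
    have h1 : x ^ 2 - D * (p ^ (m + 2) * b) ^ 2 = 1 := by rw [← hxy, hb]; ring
    have h2 : (p : ℤ) ∣ (x - 1) * (x + 1) :=
      ⟨D * p ^ 3 * y ^ 2, by linear_combination hxy⟩
    rcases hpp.dvd_or_dvd h2 with h | h
    · exact ⟨x, b, h1, h, hpb⟩
    · refine ⟨-x, b, by rw [← h1]; ring, ?_, hpb⟩
      rw [← dvd_neg]; simpa [add_comm] using h
  refine ⟨m + 2, fun i hi => ?_⟩
  induction i, hi using Nat.le_induction with
  | base => exact base
  | succ i hi ih => exact pell_raise_valuation D (by omega) ih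

/-! ### Powers of a split prime as primitive norms. -/

/-- Thue's lemma for a `p`-adic integer. -/
theorem thue_padic {p : ℕ} [Fact p.Prime] (s : ℤ_[p]) (l : ℕ) :
    ∃ a b : ℤ, (a ≠ 0 ∨ b ≠ 0) ∧ |a| ≤ p ^ l ∧ |b| ≤ p ^ l ∧
      (p : ℤ_[p]) ^ (2 * l) ∣ a + b * s := by
  have : NeZero (p ^ (2 * l)) := ⟨pow_ne_zero _ (Fact.out : p.Prime).ne_zero⟩
  let F : Fin (p ^ l + 1) × Fin (p ^ l + 1) → ZMod (p ^ (2 * l)) := fun u =>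
    PadicInt.toZModPow (2 * l) ((u.1 : ℕ) + (u.2 : ℕ) * s : ℤ_[p])
  have hcard : Fintype.card (ZMod (p ^ (2 * l))) <
      Fintype.card (Fin (p ^ l + 1) × Fin (p ^ l + 1)) := by
    rw [ZMod.card, Fintype.card_prod, Fintype.card_fin, two_mul, pow_add]
    have : 0 ≤ p ^ l := Nat.zero_le _
    generalize p ^ l = q at *
    nlinarith
  obtain ⟨u, v, huv, h⟩ := Fintype.exists_ne_map_eq_of_card_lt F hcard
  refine ⟨(u.1 : ℕ) - (v.1 : ℕ), (u.2 : ℕ) - (v.2 : ℕ), ?_, ?_, ?_, ?_⟩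
  · by_contra! hc
    apply huv
    ext <;> omega
  · have := u.1.2; have := v.1.2
    rw [abs_le, ← Nat.cast_pow]; constructor <;> omega
  · have := u.2.2; have := v.2.2
    rw [abs_le, ← Nat.cast_pow]; constructor <;> omega
  · rw [← Ideal.mem_span_singleton, ← PadicInt.ker_toZModPow, RingHom.mem_ker]
    have h' := sub_eq_zero.2 h
    simp only [F] at h'
    rw [← map_sub] at h'
    rw [← h']
    congr 1
    push_cast; ring

/-- Since `p ^ L ∤ c`, the factor `c` absorbs at most `L - 1` powers of `p`; this leaves the extra
one that `norm_form_primitive` needs. -/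
theorem padic_cancel_pow {p : ℕ} [Fact p.Prime] {c : ℤ} {L m : ℕ} {x : ℤ_[p]} (hc : c ≠ 0)
    (hcL : ¬ (p : ℤ) ^ L ∣ c) (h : (p : ℤ_[p]) ^ (m + L) ∣ c * x) : (p : ℤ_[p]) ^ (m + 1) ∣ x := by
  have hfin : FiniteMultiplicity (p : ℤ) c :=
    Int.finiteMultiplicity_iff.2 ⟨by simpa using (Fact.out : p.Prime).ne_one, hc⟩
  obtain ⟨d, hd, hpd⟩ := hfin.exists_eq_pow_mul_and_not_dvd
  set v := multiplicity (p : ℤ) c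
  have hv : v < L := by
    by_contra! hL
    exact hcL ((pow_dvd_pow _ hL).trans ⟨d, hd⟩)
  have hpp : Prime (p : ℤ_[p]) := PadicInt.prime_p
  have hpd' : ¬ (p : ℤ_[p]) ∣ d := by
    have := PadicInt.pow_p_dvd_int_iff (p := p) 1 d
    simpa using mt this.1 (by simpa using hpd)
  have h2 : (p : ℤ_[p]) ^ (v + (m + 1)) ∣ (p : ℤ_[p]) ^ v * (d * x) := by
    have e : (c : ℤ_[p]) * x = (p : ℤ_[p]) ^ v * (d * x) := by
      rw [hd]; push_cast; ring
    rw [← e]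
    exact (pow_dvd_pow _ (by omega)).trans h
  rw [pow_add] at h2
  have h3 := (mul_dvd_mul_iff_left (pow_ne_zero v hpp.ne_zero)).1 h2
  exact hpp.pow_dvd_of_dvd_mul_left _ hpd' h3

/-- Descent: if `p ∣ a` then `p ∣ b`, and dividing both by `p` lowers `m` by one while preserving
the divisibility. The descent cannot reach `m = 0`, where `p` would divide a norm equal to `1`, so
it stops at a primitive pair. -/
theorem norm_form_primitive {p : ℕ} [Fact p.Prime] (D : ℤ) (hDp : ¬ (p : ℤ) ∣ D)
    (s : ℤ_[p]) (hs : s ^ 2 = D) (m : ℕ) :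
    ∀ a b : ℤ, a ^ 2 - D * b ^ 2 = p ^ (2 * m) → (p : ℤ_[p]) ^ (m + 1) ∣ a + b * s →
    ∃ a b : ℤ, ∃ k, 1 ≤ k ∧ a ^ 2 - D * b ^ 2 = p ^ k ∧ ¬ (p : ℤ) ∣ a := by
  have hpp : Prime (p : ℤ) := Nat.prime_iff_prime_int.1 Fact.out
  have hpZ : Prime (p : ℤ_[p]) := PadicInt.prime_p
  induction m with
  | zero =>
    intro a b h1 h2
    exfalso
    have h3 : (p : ℤ_[p]) ∣ 1 := by
      have : (1 : ℤ_[p]) = (a + b * s) * (a - b * s) := by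
        have h1' : ((a ^ 2 - D * b ^ 2 : ℤ) : ℤ_[p]) = 1 := by rw [h1]; simp
        push_cast at h1'
        linear_combination -h1' + b ^ 2 * hs
      rw [this]
      exact (by simpa using h2 : (p : ℤ_[p]) ∣ _).mul_right _
    exact hpZ.not_isUnit (isUnit_of_dvd_one h3)
  | succ m ih =>
    intro a b h1 h2
    by_cases ha : (p : ℤ) ∣ a
    · obtain ⟨a', rfl⟩ := ha
      have hb : (p : ℤ) ∣ b := by
        have : (p : ℤ) ∣ D * b ^ 2 :=
          ⟨p * a' ^ 2 - p ^ (2 * m + 1), by linear_combination -h1⟩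
        exact hpp.dvd_of_dvd_pow ((hpp.dvd_or_dvd this).resolve_left hDp)
      obtain ⟨b', rfl⟩ := hb
      refine ih a' b' ?_ ?_
      · have : (p : ℤ) ^ 2 ≠ 0 := pow_ne_zero _ hpp.ne_zero
        apply mul_left_cancel₀ this
        linear_combination h1
      · have : ((p * a' : ℤ) : ℤ_[p]) + ((p * b' : ℤ) : ℤ_[p]) * s = p * (a' + b' * s) := by
          push_cast; ring
        rw [this, pow_succ'] at h2
        exact (mul_dvd_mul_iff_left hpZ.ne_zero).1 h2
    · exact ⟨a, b, _, by omega, h1, ha⟩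

/-- If `p` splits in `ℤ[√D]`, `D < 0`, then some power of `p` is primitively a norm. -/
theorem exists_norm_form_eq_prime_pow {p : ℕ} [Fact p.Prime] (D : ℤ) (hD : D < 0)
    (hDp : ¬ (p : ℤ) ∣ D) (s : ℤ_[p]) (hs : s ^ 2 = D) :
    ∃ a b : ℤ, ∃ k, 1 ≤ k ∧ a ^ 2 - D * b ^ 2 = p ^ k ∧ ¬ (p : ℤ) ∣ a := by
  have hp0 : (0 : ℤ) < p := by exact_mod_cast (Fact.out : p.Prime).pos
  have hp1 : 1 < p := (Fact.out : p.Prime).one_lt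
  have key : ∀ l : ℕ, ∃ a b c : ℤ, 0 < c ∧ c ≤ 1 - D ∧ a ^ 2 - D * b ^ 2 = p ^ (2 * l) * c ∧
      (p : ℤ_[p]) ^ (2 * l) ∣ a + b * s := by
    intro l
    obtain ⟨a, b, h0, ha, hb, h⟩ := thue_padic s l
    have h1 : (p : ℤ_[p]) ^ (2 * l) ∣ ((a ^ 2 - D * b ^ 2 : ℤ) : ℤ_[p]) := by
      have : ((a ^ 2 - D * b ^ 2 : ℤ) : ℤ_[p]) = (a + b * s) * (a - b * s) := by
        push_cast; linear_combination b ^ 2 * hs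
      rw [this]; exact h.mul_right _
    rw [PadicInt.pow_p_dvd_int_iff] at h1
    obtain ⟨c, hc⟩ := h1
    have hpl : (0 : ℤ) < p ^ (2 * l) := by positivity
    have ha2 : a ^ 2 ≤ p ^ (2 * l) := by
      rw [mul_comm, pow_mul]; exact sq_le_sq' (by linarith [(abs_le.1 ha).1]) (abs_le.1 ha).2
    have hb2 : b ^ 2 ≤ p ^ (2 * l) := by
      rw [mul_comm, pow_mul]; exact sq_le_sq' (by linarith [(abs_le.1 hb).1]) (abs_le.1 hb).2
    refine ⟨a, b, c, ?_, ?_, hc, h⟩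
    · have : 0 < (p : ℤ) ^ (2 * l) * c := by
        rw [← hc]
        rcases h0 with h0 | h0
        · have := sq_nonneg b; have : 0 < a ^ 2 := by positivity
          nlinarith
        · have := sq_nonneg a; have : 0 < b ^ 2 := by positivity
          nlinarith
      exact pos_of_mul_pos_right this hpl.le
    · have : (p : ℤ) ^ (2 * l) * c ≤ p ^ (2 * l) * (1 - D) := by
        rw [← hc]; nlinarith
      exact le_of_mul_le_mul_left this hpl
  choose a b c hc0 hc1 hn hd using key
  obtain ⟨L, hL⟩ : ∃ L : ℕ, (L : ℤ) = 1 - D := ⟨(1 - D).toNat, by omega⟩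
  have hmod : ∀ l x, x % c l < L + 1 ∧ 0 ≤ x % c l := fun l x =>
    ⟨by have := Int.emod_lt_of_pos x (hc0 l); have := hc1 l; omega,
      Int.emod_nonneg _ (hc0 l).ne'⟩
  -- Pigeonhole on the bounded cofactor `c` and on `a`, `b` modulo `c`, in place of finiteness of
  -- the class group. Indices are multiples of `L`, so that two distinct ones differ by at least
  -- `L`.
  let F : ℕ → Fin (L + 1) × Fin (L + 1) × Fin (L + 1) := fun i =>
    (⟨(c (i * L)).toNat, by have := hc1 (i * L); omega⟩,
      ⟨(a (i * L) % c (i * L)).toNat, by have := hmod (i * L) (a (i * L)); omega⟩,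
      ⟨(b (i * L) % c (i * L)).toNat, by have := hmod (i * L) (b (i * L)); omega⟩)
  obtain ⟨i, j, hij, hF⟩ : ∃ i j, i < j ∧ F i = F j := by
    obtain ⟨i, j, hij, hF⟩ := Finite.exists_ne_map_eq_of_infinite F
    rcases lt_or_gt_of_ne hij with h | h
    · exact ⟨i, j, h, hF⟩
    · exact ⟨j, i, h, hF.symm⟩
  simp only [F, Prod.mk.injEq, Fin.mk.injEq] at hF
  obtain ⟨e1, e2, e3⟩ := hF
  have hlL : i * L + L ≤ j * L := by nlinarith
  generalize i * L = l at *
  generalize j * L = l' at *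
  have ec : c l = c l' := by have := hc0 l; have := hc0 l'; omega
  have ea : (c l) ∣ a l' - a l := by
    have h1 := hmod l (a l); have h2 := hmod l' (a l')
    apply Int.ModEq.dvd; show _ % _ = _ % _
    rw [← ec] at h2 e2; omega
  have eb : (c l) ∣ b l' - b l := by
    have h1 := hmod l (b l); have h2 := hmod l' (b l')
    apply Int.ModEq.dvd; show _ % _ = _ % _
    rw [← ec] at h2 e3; omega
  obtain ⟨u, hu⟩ := ea
  obtain ⟨v, hv⟩ := eb
  have hcne : c l ≠ 0 := (hc0 l).ne'
  -- `α + β√D` is the quotient `(a' + b'√D)(a - b√D) / c`, integral because the two elements agree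
  -- modulo `c`.
  set α := p ^ (2 * l) + u * a l - D * v * b l with hα
  set β := v * a l - u * b l with hβ
  have eα : c l * α = a l' * a l - D * b l' * b l := by
    rw [hα]; linear_combination -(hn l) - a l * hu + D * b l * hv
  have eβ : c l * β = b l' * a l - a l' * b l := by
    rw [hβ]; linear_combination - a l * hv + b l * hu
  refine norm_form_primitive D hDp s hs (l + l') α β ?_ ?_
  · have h2 : c l ^ 2 ≠ 0 := pow_ne_zero _ hcne
    apply mul_left_cancel₀ h2
    have := hn l'
    rw [← ec] at this
    have e : (c l) ^ 2 * (α ^ 2 - D * β ^ 2) =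
      (a l ^ 2 - D * b l ^ 2) * (a l' ^ 2 - D * b l' ^ 2) := by
      linear_combination (c l * α + (a l' * a l - D * b l' * b l)) * eα
        - D * (c l * β + (b l' * a l - a l' * b l)) * eβ
    rw [e, this, hn l]; ring
  · refine padic_cancel_pow (L := L) (c := c l) hcne ?_ ?_
    · intro h
      have h1 := Int.le_of_dvd (hc0 l) h
      have h2 : (L : ℤ) < p ^ L := by exact_mod_cast Nat.lt_pow_self hp1
      have := hc1 l
      omega
    · have : (c l : ℤ_[p]) * (α + β * s) = (a l' + b l' * s) * (a l - b l * s) := by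
        have h1 := congrArg (Int.cast : ℤ → ℤ_[p]) eα
        have h2 := congrArg (Int.cast : ℤ → ℤ_[p]) eβ
        push_cast at h1 h2
        linear_combination h1 + s * h2 + b l' * b l * hs
      rw [this]
      exact ((pow_dvd_pow _ (by omega)).trans (hd l')).mul_right _

/-! ### Two-by-two matrices: generation of `SL₂(𝔽_p)` and anticommuting real matrices. -/

/-- A submonoid of `M₂(𝔽_p)` containing nontrivial elementary matrices of both kinds contains
`SL₂(𝔽_p)`. -/
theorem mem_of_det_eq_one {p : ℕ} [Fact p.Prime]
    (H : Submonoid (Matrix (Fin 2) (Fin 2) (ZMod p))) {x y : ZMod p} (hx : x ≠ 0) (hy : y ≠ 0)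
    (hxH : !![1, 0; x, 1] ∈ H) (hyH : !![1, y; 0, 1] ∈ H)
    (G : Matrix (Fin 2) (Fin 2) (ZMod p)) (hG : G.det = 1) : G ∈ H := by
  have lowpow : ∀ n : ℕ, !![1, 0; (n : ZMod p) * x, 1] ∈ H := by
    intro n
    induction n with
    | zero => convert H.one_mem; ext i j; fin_cases i <;> fin_cases j <;> simp
    | succ n ih =>
      convert H.mul_mem ih hxH using 1
      ext i j; fin_cases i <;> fin_cases j <;> simp [Matrix.mul_apply]; ring
  have uppow : ∀ n : ℕ, !![1, (n : ZMod p) * y; 0, 1] ∈ H := by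
    intro n
    induction n with
    | zero => convert H.one_mem; ext i j; fin_cases i <;> fin_cases j <;> simp
    | succ n ih =>
      convert H.mul_mem ih hyH using 1
      ext i j; fin_cases i <;> fin_cases j <;> simp [Matrix.mul_apply]; ring
  have low : ∀ z : ZMod p, !![1, 0; z, 1] ∈ H := by
    intro z
    have := lowpow (z / x).val
    rwa [ZMod.natCast_val, ZMod.cast_id, div_mul_cancel₀ _ hx] at this
  have up : ∀ z : ZMod p, !![1, z; 0, 1] ∈ H := by
    intro z
    have := uppow (z / y).val
    rwa [ZMod.natCast_val, ZMod.cast_id, div_mul_cancel₀ _ hy] at this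
  have gen : ∀ a b c d : ZMod p, c ≠ 0 → a * d - b * c = 1 → !![a, b; c, d] ∈ H := by
    intro a b c d hc h
    convert H.mul_mem (H.mul_mem (up ((a - 1) / c)) (low c)) (up ((d - 1) / c)) using 1
    have hb : b = (a * d - 1) / c := by field_simp; linear_combination -h
    subst hb
    ext i j; fin_cases i <;> fin_cases j <;> simp [Matrix.mul_apply] <;> field_simp <;> ring
  rw [Matrix.det_fin_two] at hG
  by_cases hc : G 1 0 = 0
  · rw [hc] at hG
    have ha : G 0 0 ≠ 0 := by rintro h; simp [h] at hG
    -- Adding the first row to the second makes the lower left entry nonzero; `low (-1)` undoes it.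
    have h1 := gen (G 0 0) (G 0 1) (G 0 0) (G 0 1 + G 1 1) ha (by linear_combination hG)
    convert H.mul_mem (low (-1)) h1 using 1
    ext i j; fin_cases i <;> fin_cases j <;> simp [Matrix.mul_apply, hc]
  · convert gen (G 0 0) (G 0 1) (G 1 0) (G 1 1) hc hG using 1
    ext i j; fin_cases i <;> fin_cases j <;> rfl

theorem zmod_two_ne_zero {p : ℕ} [Fact p.Prime] (hp : p ≠ 2) : (2 : ZMod p) ≠ 0 := by
  intro h
  have h1 : (p : ℕ) ∣ 2 := (ZMod.natCast_eq_zero_iff 2 p).1 (by exact_mod_cast h)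
  exact hp ((Nat.prime_dvd_prime_iff_eq Fact.out Nat.prime_two).1 h1)

theorem intCast_fin_two {R : Type*} [CommRing R] (z : ℤ) :
    (z : Matrix (Fin 2) (Fin 2) R) = !![(z : R), 0; 0, z] := by
  rw [← Matrix.diagonal_intCast]
  ext i j; fin_cases i <;> fin_cases j <;> simp

theorem mul_self_of_trace_eq_zero {R : Type*} [CommRing R] (A : Matrix (Fin 2) (Fin 2) R)
    (h : A 0 0 + A 1 1 = 0) : A * A = (A 0 0 ^ 2 + A 0 1 * A 1 0) • 1 := by
  have h' : A 1 1 = - A 0 0 := by linear_combination h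
  ext i j
  fin_cases i <;> fin_cases j <;> simp [Matrix.mul_apply, h'] <;> ring

/-- Two anticommuting real `2 × 2` matrices cannot both have negative square. -/
theorem real_anticomm_sq_pos (W J : Matrix (Fin 2) (Fin 2) ℝ) {q r : ℝ} (hW : W * W = q • 1)
    (hJ : J * J = r • 1) (h : W * J = -(J * W)) (hq : q < 0) (hr : r ≠ 0) : 0 < r := by
  by_contra! hr'
  have hr : r < 0 := lt_of_le_of_ne hr' hr
  have tz : ∀ (A : Matrix (Fin 2) (Fin 2) ℝ) (t : ℝ), A * A = t • 1 → t < 0 →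
      A 1 1 = - A 0 0 ∧ A 0 0 ^ 2 + A 0 1 * A 1 0 = t := by
    intro A t hA ht
    have e00 := congrFun₂ hA 0 0
    have e01 := congrFun₂ hA 0 1
    have e10 := congrFun₂ hA 1 0
    simp [Matrix.mul_apply] at e00 e01 e10
    have : A 0 0 + A 1 1 = 0 := by
      by_contra hne
      have hb : A 0 1 = 0 := by
        have : A 0 1 * (A 0 0 + A 1 1) = 0 := by linear_combination e01
        exact (mul_eq_zero.1 this).resolve_right hne
      rw [hb] at e00
      nlinarith [sq_nonneg (A 0 0)]
    exact ⟨by linarith, by linarith⟩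
  obtain ⟨w1, w2⟩ := tz W q hW hq
  obtain ⟨j1, j2⟩ := tz J r hJ hr
  have e := congrFun₂ h 0 0
  simp [Matrix.mul_apply] at e
  generalize W 0 0 = a at *
  generalize W 0 1 = b at *
  generalize W 1 0 = c at *
  generalize J 0 0 = a' at *
  generalize J 0 1 = b' at *
  generalize J 1 0 = c' at *
  -- Negative squares mean `a² < -bc` and `a'² < -b'c'`, so this square is less than `4 (bc)(b'c')`,
  -- contradicting `(bc' - b'c)² ≥ 0`.
  have h1 : (b * c' + b' * c) ^ 2 = 4 * a ^ 2 * a' ^ 2 := by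
    have : b * c' + b' * c = - 2 * (a * a') := by linarith
    rw [this]; ring
  have h2 := sq_nonneg (b * c' - b' * c)
  have h3 : a ^ 2 * a' ^ 2 < (b * c) * (b' * c') := by nlinarith [sq_nonneg a, sq_nonneg a']
  nlinarith

/-! ### Units of an indefinite quaternion order with prescribed reduction. -/

section AbstractOrder

variable {p : ℕ} [Fact p.Prime] {S : Type*} [Ring S]

/-- Reduction modulo `p` of a ring with a map to `M₂(ℤ_p)`. -/
noncomputable def redMod (l : S →+* Matrix (Fin 2) (Fin 2) ℤ_[p]) : S →+* Matrix (Fin 2) (Fin 2) (ZMod p) :=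
  (PadicInt.toZMod (p := p)).mapMatrix.comp l

theorem redMod_apply (l : S →+* Matrix (Fin 2) (Fin 2) ℤ_[p]) (x : S) (i j : Fin 2) :
    redMod l x i j = PadicInt.toZMod (l x i j) := rfl

theorem toZMod_eq_zero_iff_dvd (x : ℤ_[p]) : PadicInt.toZMod x = 0 ↔ (p : ℤ_[p]) ∣ x := by
  rw [← RingHom.mem_ker, PadicInt.ker_toZMod, PadicInt.maximalIdeal_eq_span_p,
    Ideal.mem_span_singleton]

/-- Pell's equation provides units `A + b y h²ⁿ` of a quaternion order, where `h = a - b₀ y₀` has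
norm a power of `p`. -/
theorem exists_unit_of_pell (l : S →+* Matrix (Fin 2) (Fin 2) ℤ_[p]) {y₀ y : S} {D₀ D : ℤ}
    (h₀ : y₀ * y₀ = D₀) (h : y * y = D) (hanti : y₀ * y = -(y * y₀)) (hD : 0 < D)
    (hsq : ¬ IsSquare D) {a b : ℤ} {m : ℕ} (hm : 1 ≤ m) (hab : a ^ 2 - D₀ * b ^ 2 = p ^ m) :
    ∃ (g : Sˣ) (n : ℕ) (c : ℤ), 1 ≤ n ∧ ¬ (p : ℤ) ∣ c ∧
      redMod l g = 1 + (c : Matrix (Fin 2) (Fin 2) (ZMod p)) * (redMod l y *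
        ((a : Matrix (Fin 2) (Fin 2) (ZMod p)) - b * redMod l y₀) ^ (2 * n)) := by
  obtain ⟨i₀, hi⟩ := exists_pell_valuation (p := p) hD hsq
  -- With this exponent the Pell term `p ^ (2m(i₀ + 1))` equals `(p ^ m) ^ k`, the norm factor of `u
  -- ^ k`.
  obtain ⟨A, c, h1, h2, h3⟩ := hi (m * (i₀ + 1)) (by nlinarith)
  set u : S := a - b * y₀ with hu
  set u' : S := a + b * y₀ with hu'
  set k := 2 * (i₀ + 1)
  have hcomm : ∀ (z : ℤ) (x : S), x * z = z * x := fun z x => (Int.cast_commute z x).eq.symm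
  have hsemi : SemiconjBy y u' u := by
    show y * u' = u * y
    rw [hu, hu', mul_add, sub_mul, mul_assoc _ y₀ y, hanti, hcomm, ← mul_assoc y, hcomm b y,
      mul_neg, mul_assoc]
    abel
  have hprod : u' * u = ((p ^ m : ℤ) : S) := by
    rw [← hab, hu, hu']
    have : ((a : S) + b * y₀) * (a - b * y₀) = a * a - b * b * (y₀ * y₀) := by
      rw [add_mul, mul_sub, mul_sub, mul_assoc (b : S) y₀ a, hcomm a y₀, mul_assoc (b : S) y₀,
        ← mul_assoc y₀ (b : S), hcomm b y₀, ← mul_assoc (b : S) a, hcomm a (b : S)]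
      noncomm_ring
    rw [this, h₀]; push_cast
    rw [hcomm D₀, pow_two, pow_two]
  have hprod' : u * u' = u' * u := by
    rw [hu, hu']
    have : (a : S) * (b * y₀) = b * y₀ * a := (hcomm a (b * y₀)).symm
    noncomm_ring [this]
  set v := y * u ^ k with hv
  have hvv : v * v = ((D * (p ^ m) ^ k : ℤ) : S) := by
    have e : u ^ k * y = y * u' ^ k := ((hsemi.pow_right k).eq).symm
    calc v * v = y * (u ^ k * y) * u ^ k := by rw [hv]; noncomm_ring
      _ = y * y * (u' ^ k * u ^ k) := by rw [e]; noncomm_ring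
      _ = _ := by
        rw [← (show Commute u' u from hprod'.symm).mul_pow, hprod, h]; push_cast; rfl
  -- Taking `d = c` and `d = -c` gives the right and the left inverse.
  have hone : ∀ d : ℤ, d ^ 2 = c ^ 2 → ((A : S) + d * v) * (A - d * v) = 1 := by
    intro d hd
    have e : ((A : S) + d * v) * (A - d * v) = A * A - d * d * (v * v) := by
      rw [add_mul, mul_sub, mul_sub, mul_assoc (d : S) v A, hcomm A v, mul_assoc (d : S) v,
        ← mul_assoc v (d : S), hcomm d v, ← mul_assoc (d : S) A, hcomm A (d : S)]
      noncomm_ring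
    rw [e, hvv]
    have : A * A - d * d * (D * (p ^ m) ^ k) = 1 := by
      rw [← h1, ← pow_two d, hd]; ring
    exact_mod_cast congrArg (Int.cast : ℤ → S) this
  refine ⟨⟨A + c * v, A - c * v, hone c rfl, ?_⟩, i₀ + 1, c, by omega, h3, ?_⟩
  · have := hone (-c) (by ring)
    push_cast at this
    simpa [sub_eq_add_neg] using this
  · have hA : (A : Matrix (Fin 2) (Fin 2) (ZMod p)) = 1 := by
      have : (A : ZMod p) = 1 := by
        rw [← sub_eq_zero]
        exact_mod_cast (ZMod.intCast_zmod_eq_zero_iff_dvd (A - 1) p).2 h2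
      have e := congrArg (Matrix.scalar (Fin 2)) this
      rwa [map_intCast, map_one] at e
    simp only [map_add, map_mul, map_intCast, hv, map_pow, hu, map_sub, hA]
    rfl

/-- Approximation modulo `p` by units in an indefinite quaternion order that is unramified at `p`:
a pair of anticommuting elements of suitable squares yields all of `SL₂(𝔽_p)`. -/
theorem exists_unit_redMod_eq (hp : p ≠ 2) (l : S →+* Matrix (Fin 2) (Fin 2) ℤ_[p])
    {y₀ y : S} {D₀ D : ℤ}
    (h₀ : y₀ * y₀ = D₀) (h : y * y = D) (hanti : y₀ * y = -(y * y₀)) (hD₀ : D₀ < 0) (hD : 0 < D)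
    (hsq : ¬ IsSquare D) {e : ZMod p} (he : e ≠ 0) (hr₀ : redMod l y₀ = !![1, 0; 0, -1])
    (hr : redMod l y = !![0, 2; 2 * e, 0])
    (G : Matrix (Fin 2) (Fin 2) (ZMod p)) (hG : G.det = 1) :
    ∃ g : Sˣ, redMod l g = G := by
  have h2 := zmod_two_ne_zero hp
  have hD1 : (D₀ : ZMod p) = 1 := by
    have e := congrArg (redMod l) h₀
    rw [map_mul, hr₀, map_intCast] at e
    have e := congrFun₂ e 0 0
    rw [intCast_fin_two] at e
    simpa [Matrix.mul_apply] using e.symm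
  have hDp : ¬ (p : ℤ) ∣ D₀ := by
    rw [← ZMod.intCast_zmod_eq_zero_iff_dvd, hD1]; exact one_ne_zero
  -- Hensel's lemma at `1`, as `D₀ ≡ 1` modulo the odd prime `p`.
  obtain ⟨s, hs⟩ : ∃ s : ℤ_[p], s ^ 2 = D₀ := by
    have hd : (p : ℤ) ∣ 1 - D₀ := by
      rw [← ZMod.intCast_zmod_eq_zero_iff_dvd]; push_cast; rw [hD1, sub_self]
    have hn2 : ‖(2 : ℤ_[p])‖ = 1 := by
      have : ¬ ‖((2 : ℤ) : ℤ_[p])‖ < 1 := by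
        rw [PadicInt.norm_int_lt_one_iff_dvd, ← ZMod.intCast_zmod_eq_zero_iff_dvd]
        exact_mod_cast h2
      exact le_antisymm (PadicInt.norm_le_one _) (by simpa using this)
    obtain ⟨z, hz, -⟩ := hensels_lemma (p := p)
      (F := (Polynomial.X ^ 2 - Polynomial.C (D₀ : ℤ_[p]))) (a := 1) (by
        have := (PadicInt.norm_int_lt_one_iff_dvd (p := p) (1 - D₀)).2 hd
        push_cast at this
        simpa [Polynomial.derivative_X_pow, hn2, one_add_one_eq_two] using this)
    exact ⟨z, by simpa [sub_eq_zero] using hz⟩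
  obtain ⟨a, b, m, hm, hab, hpa⟩ := exists_norm_form_eq_prime_pow D₀ hD₀ hDp s hs
  have ha0 : (a : ZMod p) ≠ 0 := by rwa [Ne, ZMod.intCast_zmod_eq_zero_iff_dvd]
  have hab0 : ((a : ZMod p) + b) * (a - b) = 0 := by
    have e := congrArg (Int.cast : ℤ → ZMod p) hab
    push_cast at e
    rw [hD1, CharP.cast_eq_zero, zero_pow (by omega)] at e
    linear_combination e
  -- The sign of `b` is chosen so that `a - b y₀` reduces to `diag(2a, 0)` and its conjugate to
  -- `diag(0, 2a)`.
  obtain ⟨b, hab, hb0⟩ : ∃ b : ℤ, a ^ 2 - D₀ * b ^ 2 = p ^ m ∧ (a : ZMod p) + b = 0 := by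
    rcases mul_eq_zero.1 hab0 with h | h
    · exact ⟨b, hab, h⟩
    · exact ⟨-b, by rw [← hab]; ring, by push_cast; linear_combination h⟩
  have hbe : (b : ZMod p) = -a := by linear_combination hb0
  have dpow : ∀ (x y : ZMod p) (n : ℕ), !![x, 0; 0, y] ^ n = !![x ^ n, 0; 0, y ^ n] := by
    intro x y n
    induction n with
    | zero => ext i j; fin_cases i <;> fin_cases j <;> simp
    | succ n ih =>
      rw [pow_succ, ih]
      ext i j; fin_cases i <;> fin_cases j <;> simp [Matrix.mul_apply, pow_succ]
  let H : Submonoid (Matrix (Fin 2) (Fin 2) (ZMod p)) :=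
    MonoidHom.mrange ((redMod l : S →* _).comp (Units.coeHom S))
  obtain ⟨g, n, c, hn, hc, hg⟩ := exists_unit_of_pell l h₀ h hanti hD hsq hm hab
  obtain ⟨g', n', c', hn', hc', hg'⟩ := exists_unit_of_pell (a := a) (b := -b) (m := m) l h₀ h hanti hD hsq hm
    (by rw [← hab]; ring)
  rw [← ZMod.intCast_zmod_eq_zero_iff_dvd] at hc hc'
  have hlow : redMod l g = !![1, 0; (c : ZMod p) * (2 * e) * (2 * a) ^ (2 * n), 1] := by
    have : (a : Matrix (Fin 2) (Fin 2) (ZMod p)) - b * redMod l y₀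
        = !![2 * (a : ZMod p), 0; 0, 0] := by
      rw [hr₀, intCast_fin_two, intCast_fin_two, hbe]
      ext i j; fin_cases i <;> fin_cases j <;> simp; ring
    rw [hg, this, dpow, hr, intCast_fin_two, zero_pow (by omega)]
    ext i j; fin_cases i <;> fin_cases j <;> simp; ring
  have hup : redMod l g' = !![1, (c' : ZMod p) * 2 * (2 * a) ^ (2 * n'); 0, 1] := by
    have : (a : Matrix (Fin 2) (Fin 2) (ZMod p)) - ((-b : ℤ) : Matrix _ _ _) * redMod l y₀
        = !![0, 0; 0, 2 * (a : ZMod p)] := by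
      rw [hr₀, intCast_fin_two, intCast_fin_two, Int.cast_neg, hbe]
      ext i j; fin_cases i <;> fin_cases j <;> simp; ring
    rw [hg', this, dpow, hr, intCast_fin_two, zero_pow (by omega)]
    ext i j; fin_cases i <;> fin_cases j <;> simp; ring
  have : G ∈ H := by
    refine mem_of_det_eq_one H ?_ ?_ ⟨g, hlow⟩ ⟨g', hup⟩ G hG
    · exact mul_ne_zero (mul_ne_zero hc (mul_ne_zero h2 he)) (pow_ne_zero _ (mul_ne_zero h2 ha0))
    · exact mul_ne_zero (mul_ne_zero hc' h2) (pow_ne_zero _ (mul_ne_zero h2 ha0))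
  obtain ⟨g, hg⟩ := this
  exact ⟨g, hg⟩

end AbstractOrder

section AbstractOrder

variable {p : ℕ} [Fact p.Prime] {S : Type*} [Ring S]

theorem intCast_inj_of_matrix (l : S →+* Matrix (Fin 2) (Fin 2) ℤ_[p]) {m n : ℤ}
    (h : (m : S) = n) : m = n := by
  have e := congrArg l h
  rw [map_intCast, map_intCast, intCast_fin_two, intCast_fin_two] at e
  have := congrFun₂ e 0 0
  simpa using this

theorem exists_sq_eq_intCast (l : S →+* Matrix (Fin 2) (Fin 2) ℤ_[p])
    (hscal : ∀ x (z : ℤ_[p]), l x = z • 1 → ∃ n : ℤ, x = n) {x : S}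
    (hx : l x 0 0 + l x 1 1 = 0) : ∃ n : ℤ, x * x = n :=
  hscal _ _ (by rw [map_mul, mul_self_of_trace_eq_zero _ hx])

theorem trace_commutator (l : S →+* Matrix (Fin 2) (Fin 2) ℤ_[p]) (x y : S) :
    l (x * y - y * x) 0 0 + l (x * y - y * x) 1 1 = 0 := by
  simp [Matrix.mul_apply]; ring

/-- A matrix with scalar square and nonzero trace is scalar; `x` would then be an integer with
negative square. -/
theorem trace_eq_zero_of_sq_neg (l : S →+* Matrix (Fin 2) (Fin 2) ℤ_[p])
    (hscal : ∀ x (z : ℤ_[p]), l x = z • 1 → ∃ n : ℤ, x = n) {x : S} {d : ℤ} (hd : d < 0)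
    (hx : x * x = d) : l x 0 0 + l x 1 1 = 0 := by
  by_contra hne
  have e := congrArg l hx
  rw [map_mul, map_intCast, intCast_fin_two] at e
  have e00 := congrFun₂ e 0 0
  have e01 := congrFun₂ e 0 1
  have e10 := congrFun₂ e 1 0
  have e11 := congrFun₂ e 1 1
  simp [Matrix.mul_apply] at e00 e01 e10 e11
  have hb : l x 0 1 = 0 := by
    have : l x 0 1 * (l x 0 0 + l x 1 1) = 0 := by linear_combination e01
    exact (mul_eq_zero.1 this).resolve_right hne
  have hc : l x 1 0 = 0 := by
    have : l x 1 0 * (l x 0 0 + l x 1 1) = 0 := by linear_combination e10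
    exact (mul_eq_zero.1 this).resolve_right hne
  have ha : l x 0 0 = l x 1 1 := by
    have : (l x 0 0 - l x 1 1) * (l x 0 0 + l x 1 1) = 0 := by linear_combination e00 - e11
    exact sub_eq_zero.1 ((mul_eq_zero.1 this).resolve_right hne)
  obtain ⟨n, rfl⟩ := hscal x (l x 0 0) (by
    ext i j; fin_cases i <;> fin_cases j <;> simp [hb, hc, ha])
  have : n * n = d := intCast_inj_of_matrix l (by rw [← hx]; push_cast; rfl)
  nlinarith [mul_self_nonneg n]

/-- An indefinite quaternion order, unramified at `p`, containing an imaginary quadratic element: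
its units surject onto `SL₂(𝔽_p)`. -/
theorem exists_unit_redMod_eq_of_indefinite (hp : p ≠ 2) {ε : ℤ} (hε : ¬ IsSquare (ε : ZMod p))
    (l : S →+* Matrix (Fin 2) (Fin 2) ℤ_[p]) (hsurj : Function.Surjective (redMod l))
    (hscal : ∀ x (z : ℤ_[p]), l x = z • 1 → ∃ n : ℤ, x = n)
    (r : S →+* Matrix (Fin 2) (Fin 2) ℝ) {w : S} {d : ℤ} (hd : d < 0) (hw : w * w = d)
    (G : Matrix (Fin 2) (Fin 2) (ZMod p)) (hG : G.det = 1) :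
    ∃ g : Sˣ, redMod l g = G := by
  obtain ⟨x, hx⟩ := hsurj !![0, 1; 0, 0]
  obtain ⟨z, hz⟩ := hsurj !![0, 0; 1, 0]
  -- The sign of `ε` is set so that the commutator with `diag(1, -1)` is `(0, 2; 2ε, 0)`.
  obtain ⟨z', hz'⟩ := hsurj !![0, 1; -(ε : ZMod p), 0]
  set y₁ := x * z - z * x with hy₁
  have ty₁ := trace_commutator l x z
  have tw := trace_eq_zero_of_sq_neg l hscal hd hw
  obtain ⟨D₁, hD₁⟩ := exists_sq_eq_intCast l hscal ty₁
  rw [← hy₁] at hD₁ ty₁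
  obtain ⟨q, hq⟩ := exists_sq_eq_intCast l hscal (x := y₁ + w) (by
    simp only [map_add, Matrix.add_apply]; linear_combination ty₁ + tw)
  have hpol : y₁ * w + w * y₁ = ((q - D₁ - d : ℤ) : S) := by
    push_cast
    rw [← hq, ← hD₁, ← hw]; noncomm_ring
  set s := q - D₁ - d
  set N : ℤ := |D₁| + |s| + 1 with hN
  set y₀ := y₁ + ((p * N : ℤ) : S) * w with hy₀
  set D₀ := D₁ + p * N * s + (p * N) ^ 2 * d with hD₀
  have hcomm : ∀ (z : ℤ) (x : S), x * z = z * x := fun z x => (Int.cast_commute z x).eq.symm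
  have h₀ : y₀ * y₀ = D₀ := by
    have : y₀ * y₀ = y₁ * y₁ + ((p * N : ℤ) : S) * (y₁ * w + w * y₁)
        + ((p * N : ℤ) : S) * ((p * N : ℤ) : S) * (w * w) := by
      rw [hy₀, mul_add, add_mul, add_mul, ← mul_assoc y₁, hcomm _ y₁,
        mul_assoc _ w (_ * w), ← mul_assoc w, hcomm _ w]
      noncomm_ring
    rw [this, hD₁, hpol, hw, hD₀]; push_cast; noncomm_ring
  have hD₀neg : D₀ < 0 := by
    have hp1 : (1 : ℤ) ≤ p := by exact_mod_cast (Fact.out : p.Prime).one_le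
    have h1 := le_abs_self D₁
    have h2 := le_abs_self s
    have h3 := abs_nonneg D₁
    have h4 := abs_nonneg s
    have hNp : N ≤ p * N := by nlinarith
    generalize (p : ℤ) * N = P at *
    have h5 : P ^ 2 * d ≤ - P ^ 2 := by nlinarith [sq_nonneg P]
    have h6 : P * s ≤ P * |s| := by nlinarith
    have h7 : (|D₁| + 1) * 1 ≤ (P - |s|) * P := by nlinarith
    nlinarith
  have hr₀ : redMod l y₀ = !![1, 0; 0, -1] := by
    have h0 : redMod l (((p * N : ℤ) : S) * w) = 0 := by
      have : ((p * N : ℤ) : ZMod p) = 0 := by simp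
      rw [map_mul, map_intCast, intCast_fin_two, this]
      ext i j; fin_cases i <;> simp [Matrix.mul_apply]
    rw [hy₀, hy₁, map_add, h0, map_sub, map_mul, map_mul, hx, hz]
    ext i j; fin_cases i <;> fin_cases j <;> simp
  set y := y₀ * z' - z' * y₀ with hy
  obtain ⟨D, hD⟩ := exists_sq_eq_intCast l hscal (trace_commutator l y₀ z')
  rw [← hy] at hD
  have hanti : y₀ * y = -(y * y₀) := by
    rw [hy, mul_sub, sub_mul, ← mul_assoc y₀ y₀, h₀, mul_assoc z' y₀, h₀, hcomm]
    noncomm_ring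
  have hry : redMod l y = !![0, 2; 2 * (ε : ZMod p), 0] := by
    rw [hy, map_sub, map_mul, map_mul, hr₀, hz']
    ext i j; fin_cases i <;> fin_cases j <;> simp <;> ring
  have hε0 : (ε : ZMod p) ≠ 0 := fun h => hε (h ▸ IsSquare.zero)
  have h2 := zmod_two_ne_zero hp
  have hDε : (D : ZMod p) = 4 * ε := by
    have e := congrArg (redMod l) hD
    rw [map_mul, hry, map_intCast, intCast_fin_two] at e
    have e := congrFun₂ e 0 0
    simp at e
    rw [← e]; ring
  have hDsq : ¬ IsSquare D := by
    rintro ⟨t, ht⟩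
    refine hε ⟨t / 2, ?_⟩
    have : (D : ZMod p) = t * t := by rw [ht]; push_cast; rfl
    field_simp
    linear_combination this - hDε
  have hDne : D ≠ 0 := by
    rintro rfl; exact hDsq IsSquare.zero
  have hDpos : 0 < D := by
    have := real_anticomm_sq_pos (r y₀) (r y) (q := D₀) (r := D)
      (by rw [← map_mul, h₀, map_intCast, intCast_fin_two]
          ext i j; fin_cases i <;> fin_cases j <;> simp)
      (by rw [← map_mul, hD, map_intCast, intCast_fin_two]
          ext i j; fin_cases i <;> fin_cases j <;> simp)
      (by rw [← map_mul, hanti, map_neg, map_mul]) (by exact_mod_cast hD₀neg)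
      (by exact_mod_cast hDne)
    exact_mod_cast this
  exact exists_unit_redMod_eq hp l h₀ hD hanti hD₀neg hDpos hDsq hε0 hr₀ hry G hG

end AbstractOrder

/-! ### Conjugacy in `M₂(𝔽_p)`. -/

/-- A trace zero matrix over `𝔽_p` whose square is a nonsquare scalar is conjugate under
`SL₂(𝔽_p)` to a multiple of `(0, 1; ε, 0)`, for `ε` a nonsquare. -/
theorem exists_conj_antidiagonal {p : ℕ} [Fact p.Prime] (hp : p ≠ 2) {ε : ZMod p}
    (hε : ¬ IsSquare ε) (A : Matrix (Fin 2) (Fin 2) (ZMod p)) (htr : A 0 0 + A 1 1 = 0)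
    (hA : ¬ IsSquare (A 0 0 ^ 2 + A 0 1 * A 1 0)) :
    ∃ (G : Matrix (Fin 2) (Fin 2) (ZMod p)) (t : ZMod p), G.det = 1 ∧ t ≠ 0 ∧
      A * G = G * !![0, t; ε * t, 0] := by
  have hd : A 1 1 = - A 0 0 := by linear_combination htr
  obtain ⟨a, ha⟩ : ∃ a, a = A 0 0 := ⟨_, rfl⟩
  obtain ⟨b, hb⟩ : ∃ b, b = A 0 1 := ⟨_, rfl⟩
  obtain ⟨c, hc⟩ : ∃ c, c = A 1 0 := ⟨_, rfl⟩
  rw [← ha, ← hb, ← hc] at hA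
  have hAe : A = !![a, b; c, -a] := by
    ext i j; fin_cases i <;> fin_cases j <;> simp [*]
  have hc0 : c ≠ 0 := by
    rintro h
    rw [h, mul_zero, add_zero] at hA
    exact hA (IsSquare.sq a)
  set η := a ^ 2 + b * c with hη
  have hε0 : ε ≠ 0 := fun h => hε (h ▸ IsSquare.zero)
  have hη0 : η ≠ 0 := fun h => hA (h ▸ IsSquare.zero)
  obtain ⟨q, hq⟩ : IsSquare (η * ε) := by
    have hp' : ringChar (ZMod p) ≠ 2 := by rwa [ZMod.ringChar_zmod_n]
    rw [← quadraticChar_one_iff_isSquare (mul_ne_zero hη0 hε0), map_mul,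
      (quadraticChar_neg_one_iff_not_isSquare).2 hA, (quadraticChar_neg_one_iff_not_isSquare).2 hε]
    norm_num
  have hq0 : q ≠ 0 := by
    rintro rfl; exact mul_ne_zero hη0 hε0 (by simpa using hq)
  -- The columns of `G` will be `g₁` and `A g₁ / q`. Then `det G = 1` says that a binary form, `X² -
  -- ηY²` after completing the square, takes the value `c q`; such a form is universal over `𝔽_p`.
  obtain ⟨X, Y, hXY⟩ : ∃ X Y : ZMod p, X ^ 2 - η * Y ^ 2 = c * q := by
    obtain ⟨X, Y, h⟩ := FiniteField.exists_root_sum_quadratic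
      (f := Polynomial.X ^ 2 - Polynomial.C (c * q))
      (g := Polynomial.C (-η) * Polynomial.X ^ 2)
      (Polynomial.degree_X_pow_sub_C (by norm_num) _)
      (by rw [Polynomial.degree_C_mul_X_pow _ (neg_ne_zero.2 hη0)]; rfl)
      (by rw [ZMod.card]; exact ((Fact.out : p.Prime).eq_two_or_odd).resolve_left hp)
    refine ⟨X, Y, ?_⟩
    simp at h
    linear_combination h
  have hη' : η = q * q / ε := by field_simp; rw [hq, pow_two]
  refine ⟨!![(X + a * Y) / c, (a * ((X + a * Y) / c) + b * Y) / q;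
    Y, (c * ((X + a * Y) / c) - a * Y) / q], q / ε, ?_, div_ne_zero hq0 hε0, ?_⟩
  · rw [Matrix.det_fin_two_of]
    field_simp
    linear_combination hXY - Y ^ 2 * hη
  · have hbc : b = (η - a ^ 2) / c := by field_simp; rw [hη]; ring
    rw [hAe, hbc, hη']
    ext i j; fin_cases i <;> fin_cases j <;> simp <;> field_simp <;> ring

/-! ### Elements of negative square in an imaginary quadratic field. -/

theorem exists_eq_add_mul_of_finrank_two {K : Type*} [Field K] [NumberField K]
    (hK : Module.finrank ℚ K = 2) {w : K} (hw : ∀ q : ℚ, w ≠ algebraMap ℚ K q) (x : K) :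
    ∃ a b : ℚ, x = algebraMap ℚ K a + algebraMap ℚ K b * w := by
  have hdep : ¬ LinearIndependent ℚ ![1, w, x] := by
    intro h
    have := h.fintype_card_le_finrank
    rw [hK] at this
    simp at this
  obtain ⟨g, hg, i, hi⟩ := Fintype.not_linearIndependent_iff.1 hdep
  simp [Fin.sum_univ_three, Algebra.smul_def] at hg
  have hmap : ∀ q : ℚ, algebraMap ℚ K q = q := fun q => by simp
  have h2 : g 2 ≠ 0 := by
    intro h2
    have h1 : g 1 ≠ 0 := by
      intro h1
      have h0 : g 0 = 0 := by simpa [h1, h2] using hg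
      fin_cases i <;> simp_all
    apply hw (- g 0 / g 1)
    have h1' : (g 1 : K) ≠ 0 := by rw [← hmap]; simpa using h1
    rw [h2] at hg
    simp only [hmap]; push_cast
    field_simp
    simp only [Rat.cast_zero, zero_mul, add_zero] at hg
    linear_combination hg
  have h2' : (g 2 : K) ≠ 0 := by rw [← hmap]; simpa using h2
  refine ⟨- g 0 / g 2, - g 1 / g 2, ?_⟩
  simp only [hmap]; push_cast
  field_simp
  linear_combination hg

/-- Complete the square in a quadratic relation; a positive `q` would make a complex embedding real.
-/
theorem exists_sq_neg_of_imaginary_quadratic {K : Type*} [Field K] [NumberField K]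
    (hK : Module.finrank ℚ K = 2) (hKim : NumberField.IsTotallyComplex K) :
    ∃ (w : K) (q : ℚ), q < 0 ∧ w * w = algebraMap ℚ K q := by
  obtain ⟨α, hα⟩ : ∃ α : K, ∀ q : ℚ, α ≠ algebraMap ℚ K q := by
    by_contra! h
    have hs : Function.Surjective (algebraMap ℚ K) := fun x => by
      obtain ⟨q, hq⟩ := h x; exact ⟨q, hq.symm⟩
    have := (LinearMap.finrank_le_finrank_of_surjective (f := Algebra.linearMap ℚ K) hs)
    rw [hK] at this
    simp at this
  obtain ⟨a, b, hab⟩ := exists_eq_add_mul_of_finrank_two hK hα (α * α)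
  set w := 2 * α - algebraMap ℚ K b with hw
  set q := 4 * a + b ^ 2
  have hwq : w * w = algebraMap ℚ K q := by
    simp only [q, map_add, map_mul, map_pow, map_ofNat, hw]; linear_combination 4 * hab
  have hwne : ∀ r : ℚ, w ≠ algebraMap ℚ K r := by
    intro r hr
    apply hα ((r + b) / 2)
    rw [map_div₀, map_add, map_ofNat, ← hr, hw]; ring
  refine ⟨w, q, ?_, hwq⟩
  by_contra! hq
  have hq0 : 0 < q := by
    refine lt_of_le_of_ne hq (fun h => hwne 0 ?_)
    rw [← h, map_zero, mul_self_eq_zero] at hwq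
    rw [hwq, map_zero]
  obtain ⟨v⟩ : Nonempty (NumberField.InfinitePlace K) := inferInstance
  have hv := hKim.isComplex v
  rw [← NumberField.InfinitePlace.not_isReal_iff_isComplex] at hv
  apply hv
  rw [NumberField.InfinitePlace.isReal_iff, NumberField.ComplexEmbedding.isReal_iff]
  set φ := v.embedding
  have hsq : φ w * φ w = (q : ℂ) := by rw [← map_mul, hwq]; simp
  have hreal : (starRingEnd ℂ) (φ w) = φ w := by
    rw [Complex.conj_eq_iff_im]
    have h1 := congrArg Complex.re hsq
    have h2 := congrArg Complex.im hsq
    simp at h1 h2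
    rcases (show (φ w).re = 0 ∨ (φ w).im = 0 by
      rw [← mul_eq_zero]; linarith) with h | h
    · have hq0' : (0 : ℝ) < q := by exact_mod_cast hq0
      rw [h] at h1
      nlinarith [mul_self_nonneg (φ w).im]
    · exact h
  ext x
  obtain ⟨a, b, rfl⟩ := exists_eq_add_mul_of_finrank_two hK hwne x
  simp [NumberField.ComplexEmbedding.conjugate_coe_eq, hreal]

theorem exists_int_sq_neg_mem_orderOfConductor {K : Type*} [Field K] [NumberField K]
    (hK : Module.finrank ℚ K = 2) (hKim : NumberField.IsTotallyComplex K) {f : ℕ} (hf : 0 < f) :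
    ∃ w ∈ orderOfConductor K f, ∃ d : ℤ, d < 0 ∧ w * w = d := by
  obtain ⟨w, q, hq, hw⟩ := exists_sq_neg_of_imaginary_quadratic hK hKim
  have hden : (q.den : K) ≠ 0 := by exact_mod_cast q.den_ne_zero
  have hqK : (q.den : K) * algebraMap ℚ K q = q.num := by
    rw [eq_ratCast, mul_comm]; exact_mod_cast Rat.mul_den_eq_num q
  set u : K := q.den * w with hu
  have huu : u * u = ((q.den * q.num : ℤ) : K) := by
    push_cast
    rw [← hqK, ← hw, hu]; ring
  have hint : IsIntegral ℤ u := by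
    refine IsIntegral.of_pow (n := 2) (by norm_num) ?_
    rw [pow_two, huu]
    exact isIntegral_algebraMap (R := ℤ) (A := K) (x := (q.den * q.num : ℤ))
  refine ⟨f * u, ⟨0, ⟨u, hint⟩, by rw [Int.cast_zero, zero_add]; rfl⟩, f ^ 2 * (q.den * q.num), ?_, ?_⟩
  · have h1 : q.num < 0 := Rat.num_neg.2 hq
    have h2 : (0 : ℤ) < q.den := by exact_mod_cast q.den_pos
    have h3 : (0 : ℤ) < f := by exact_mod_cast hf
    have : (q.den : ℤ) * q.num < 0 := mul_neg_of_pos_of_neg h2 h1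
    exact mul_neg_of_pos_of_neg (by positivity) this
  · push_cast at huu ⊢
    linear_combination (f : K) ^ 2 * huu

/-! ### Reduction modulo `p` of the order of conductor `f`. -/

section Optimal

variable {p : ℕ} [Fact p.Prime] {K : Type*} [Field K] [NumberField K] {f : ℕ}

theorem natCast_mul_mem_orderOfConductor (f : ℕ) (y : 𝓞 K) :
    (f : K) * y ∈ orderOfConductor K f := ⟨0, y, by simp⟩

theorem exists_ringOfIntegers_eq {x : K} (hx : x ∈ orderOfConductor K f) :
    ∃ y : 𝓞 K, (y : K) = x := by
  obtain ⟨a, y, rfl⟩ := hx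
  exact ⟨a + f * y, by push_cast; rfl⟩

/-- A ring homomorphism from the order of conductor `f` to `M₂(𝔽_p)`, `p` inert and prime to `f`,
has kernel in `p 𝓞_K`. -/
theorem exists_eq_mul_of_map_eq_zero (hinert : (Ideal.span {(p : 𝓞 K)}).IsPrime)
    (hpf : ¬ p ∣ f) (μ : orderOfConductor K f →+* Matrix (Fin 2) (Fin 2) (ZMod p))
    {z : orderOfConductor K f} (hz : μ z = 0) : ∃ v : 𝓞 K, (z : K) = p * v := by
  obtain ⟨ζ, hζ⟩ := exists_ringOfIntegers_eq z.2
  by_contra hcon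
  have hp0 : (p : 𝓞 K) ≠ 0 := by exact_mod_cast (Fact.out : p.Prime).ne_zero
  have hmax : (Ideal.span {(p : 𝓞 K)}).IsMaximal :=
    hinert.isMaximal (by simpa [Ideal.span_singleton_eq_bot] using hp0)
  obtain ⟨y, i, hi, hyi⟩ := hmax.exists_inv (x := ζ) (by
    rw [Ideal.mem_span_singleton]
    rintro ⟨v, hv⟩
    exact hcon ⟨v, by rw [← hζ, hv]; push_cast; rfl⟩)
  obtain ⟨v, rfl⟩ := Ideal.mem_span_singleton.1 hi
  let Y : orderOfConductor K f := ⟨f * y, natCast_mul_mem_orderOfConductor f y⟩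
  let V : orderOfConductor K f := ⟨f * v, natCast_mul_mem_orderOfConductor f v⟩
  -- An inverse of `z` modulo `p 𝓞_K`, multiplied by `f` to fall inside the order; applying `μ`
  -- gives `f ≡ 0`.
  have e : Y * z + (p : ℕ) * V = (f : ℕ) := by
    apply Subtype.ext
    have := congrArg (algebraMap (𝓞 K) K) hyi
    push_cast at this
    simp only [Y, V]
    push_cast
    rw [← hζ]
    linear_combination (f : K) * this
  have e' := congrArg μ e
  rw [map_add, map_mul, map_mul, hz, map_natCast, map_natCast, mul_zero, zero_add] at e'
  have h1 := intCast_fin_two (R := ZMod p) p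
  have h2 := intCast_fin_two (R := ZMod p) f
  push_cast at h1 h2
  rw [h1, h2] at e'
  have := congrFun₂ e' 0 0
  simp [Matrix.mul_apply] at this
  exact hpf ((ZMod.natCast_eq_zero_iff f p).1 this.symm)

/-- The elements of the order of conductor `f` that reduce to scalars lie in the order of
conductor `p f`. -/
theorem mem_orderOfConductor_of_map_eq_intCast (hinert : (Ideal.span {(p : 𝓞 K)}).IsPrime)
    (hpf : ¬ p ∣ f) (μ : orderOfConductor K f →+* Matrix (Fin 2) (Fin 2) (ZMod p))
    {z : orderOfConductor K f} {a : ℤ} (hz : μ z = a) :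
    (z : K) ∈ orderOfConductor K (p * f) := by
  obtain ⟨v, hv⟩ := exists_eq_mul_of_map_eq_zero hinert hpf μ (z := z - a)
    (by rw [map_sub, map_intCast, hz, sub_self])
  obtain ⟨c, y, hy⟩ := z.2
  have hcop : IsCoprime (p : ℤ) (f : ℤ) :=
    Nat.isCoprime_iff_coprime.2 ((Nat.Prime.coprime_iff_not_dvd Fact.out).2 hpf)
  obtain ⟨β, α, hβα⟩ := hcop
  have hβα' : (β : K) * p + α * f = 1 := by exact_mod_cast congrArg (Int.cast : ℤ → K) hβα
  push_cast at hv
  refine ⟨c + α * f * (a - c), α * v + β * y, ?_⟩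
  simp only [map_add, map_mul, map_intCast]
  push_cast
  linear_combination (α * f : K) * hv + (β * p : K) * hy + (c - z : K) * hβα'

/-- If every image were scalar, `𝔽_p` would surject onto `𝓞_K / p`, which has `p²` elements. -/
theorem exists_map_ne_intCast (hK : Module.finrank ℚ K = 2)
    (hinert : (Ideal.span {(p : 𝓞 K)}).IsPrime)
    (hpf : ¬ p ∣ f) (μ : orderOfConductor K f →+* Matrix (Fin 2) (Fin 2) (ZMod p)) :
    ∃ z, ∀ a : ℤ, μ z ≠ a := by
  by_contra! h
  have hpp : p.Prime := Fact.out
  let Q := 𝓞 K ⧸ (Ideal.span {(p : 𝓞 K)})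
  have hcard : Nat.card Q = p ^ 2 := by
    have := Ideal.absNorm_span_natCast (S := 𝓞 K) p
    rwa [Ideal.absNorm_apply, Submodule.cardQuot_apply, NumberField.RingOfIntegers.rank, hK] at this
  have hcop : IsCoprime (p : ℤ) (f : ℤ) :=
    Nat.isCoprime_iff_coprime.2 ((Nat.Prime.coprime_iff_not_dvd Fact.out).2 hpf)
  obtain ⟨β, α, hβα⟩ := hcop
  have hpQ : ((p : ℕ) : Q) = 0 := by
    have := Ideal.Quotient.eq_zero_iff_mem.2 (Ideal.mem_span_singleton_self (p : 𝓞 K))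
    simpa using this
  have hcp : CharP Q p := by
    have : Nontrivial Q := Ideal.Quotient.nontrivial_iff.2 hinert.ne_top
    have hdvd : ringChar Q ∣ p := ringChar.dvd hpQ
    rcases (Nat.dvd_prime hpp).1 hdvd with h1 | h1
    · exact absurd h1 (CharP.ringChar_ne_one)
    · exact ringChar.of_eq h1
  have hsurj : Function.Surjective (ZMod.castHom (dvd_refl p) Q) := by
    intro x
    obtain ⟨y, rfl⟩ := Ideal.Quotient.mk_surjective x
    obtain ⟨a, ha⟩ := h ⟨f * y, natCast_mul_mem_orderOfConductor f y⟩
    obtain ⟨v, hv⟩ := exists_eq_mul_of_map_eq_zero hinert hpf μ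
      (z := ⟨f * y, natCast_mul_mem_orderOfConductor f y⟩ - a)
      (by rw [map_sub, map_intCast, ha, sub_self])
    have hv' : (f : 𝓞 K) * y - a = p * v := by
      apply NumberField.RingOfIntegers.coe_injective
      push_cast at hv
      simp only [map_sub, map_mul, map_natCast, map_intCast]
      exact hv
    have e1 := congrArg (Ideal.Quotient.mk (Ideal.span {(p : 𝓞 K)})) hv'
    have e0 : (β : 𝓞 K) * p + α * f = 1 := by
      exact_mod_cast congrArg (Int.cast : ℤ → 𝓞 K) hβα
    have e2 := congrArg (Ideal.Quotient.mk (Ideal.span {(p : 𝓞 K)})) e0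
    simp only [map_sub, map_mul, map_natCast, map_intCast] at e1
    simp only [map_add, map_mul, map_natCast, map_intCast, map_one] at e2
    refine ⟨((α * a : ℤ) : ZMod p), ?_⟩
    rw [map_intCast]; push_cast
    rw [hpQ] at e1 e2
    linear_combination (-(α : Q)) * e1 + (Ideal.Quotient.mk _ y) * e2
  have := Nat.card_le_card_of_surjective _ hsurj
  rw [hcard, Nat.card_zmod] at this
  nlinarith [hpp.two_le]

/-- The order of conductor `f` contains an element whose image in `M₂(𝔽_p)` has trace zero and
nonsquare determinant up to sign. -/
theorem exists_map_trace_zero_nonsquare (hp : p ≠ 2) (hK : Module.finrank ℚ K = 2)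
    (hinert : (Ideal.span {(p : 𝓞 K)}).IsPrime)
    (hpf : ¬ p ∣ f) (μ : orderOfConductor K f →+* Matrix (Fin 2) (Fin 2) (ZMod p)) :
    ∃ w, μ w 0 0 + μ w 1 1 = 0 ∧ ¬ IsSquare (μ w 0 0 ^ 2 + μ w 0 1 * μ w 1 0) := by
  obtain ⟨x, hx⟩ := exists_map_ne_intCast hK hinert hpf μ
  have h2 := zmod_two_ne_zero hp
  obtain ⟨t, ht⟩ := ZMod.intCast_surjective (μ x 0 0 + μ x 1 1)
  set w := x + x - t with hw
  have hμw : μ w = μ x + μ x - !![(t : ZMod p), 0; 0, t] := by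
    rw [hw, map_sub, map_add, map_intCast, intCast_fin_two]
  have htr : μ w 0 0 + μ w 1 1 = 0 := by
    rw [hμw]; simp [ht]
  have hns : ∀ r : ℤ, μ w ≠ r := by
    intro r hr
    obtain ⟨s, hs⟩ := ZMod.intCast_surjective (((r : ZMod p) + (t : ZMod p)) / 2)
    have hs' : 2 * (s : ZMod p) = r + t := by rw [hs]; field_simp
    apply hx s
    rw [hμw, intCast_fin_two] at hr
    rw [intCast_fin_two]
    have h00 := congrFun₂ hr 0 0
    have h01 := congrFun₂ hr 0 1
    have h10 := congrFun₂ hr 1 0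
    have h11 := congrFun₂ hr 1 1
    simp at h00 h01 h10 h11
    ext i j; fin_cases i <;> fin_cases j <;> simp <;> apply mul_left_cancel₀ h2
    · linear_combination h00 - hs'
    · linear_combination h01
    · linear_combination h10
    · linear_combination h11 - hs'
  refine ⟨w, htr, ?_⟩
  rintro ⟨r', hr'⟩
  obtain ⟨r, rfl⟩ := ZMod.intCast_surjective r'
  -- A square root `r` would put `(w - r)(w + r)` in the prime `p 𝓞_K`, making `μ w` scalar.
  have hker : μ ((w - r) * (w + r)) = 0 := by
    have : (w - r) * (w + r) = w * w - ((r * r : ℤ) : orderOfConductor K f) := by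
      push_cast; ring
    rw [this, map_sub, map_mul, mul_self_of_trace_eq_zero _ htr, hr', map_intCast, intCast_fin_two]
    ext i j; fin_cases i <;> fin_cases j <;> simp
  obtain ⟨v, hv⟩ := exists_eq_mul_of_map_eq_zero hinert hpf μ hker
  obtain ⟨ω, hω⟩ := exists_ringOfIntegers_eq w.2
  have hdvd : (p : 𝓞 K) ∣ (ω - r) * (ω + r) := by
    refine ⟨v, ?_⟩
    apply NumberField.RingOfIntegers.coe_injective
    push_cast at hv
    simp only [map_sub, map_add, map_mul, map_natCast, map_intCast, hω]
    exact hv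
  have hno : ∀ s : ℤ, ¬ (p : 𝓞 K) ∣ ω - s := by
    rintro s ⟨u, hu⟩
    let U : orderOfConductor K f := ⟨f * u, natCast_mul_mem_orderOfConductor f u⟩
    have e : (f : ℕ) * (w - s) = (p : ℕ) * U := by
      apply Subtype.ext
      have := congrArg (algebraMap (𝓞 K) K) hu
      simp only [map_sub, map_mul, map_natCast, map_intCast] at this
      simp only [U]
      push_cast
      rw [← hω]
      linear_combination (f : K) * this
    have e' := congrArg μ e
    rw [map_mul, map_mul, map_natCast, map_natCast, map_sub, map_intCast] at e'
    have h1 := intCast_fin_two (R := ZMod p) p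
    have h2 := intCast_fin_two (R := ZMod p) f
    push_cast at h1 h2
    have hf0 : (f : ZMod p) ≠ 0 := by rwa [Ne, ZMod.natCast_eq_zero_iff]
    apply hns s
    rw [h1, h2, intCast_fin_two] at e'
    rw [intCast_fin_two]
    rw [← sub_eq_zero]
    ext i j
    have := congrFun₂ e' i j
    fin_cases i <;> fin_cases j <;> simpa [Matrix.mul_apply, Matrix.vecMul, hf0] using this
  have hprime : Prime (p : 𝓞 K) := by
    rwa [← Ideal.span_singleton_prime (by exact_mod_cast (Fact.out : p.Prime).ne_zero)]
  rcases hprime.dvd_or_dvd hdvd with h | h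
  · exact hno r h
  · exact hno (-r) (by push_cast; rwa [sub_neg_eq_add])

end Optimal

/-! ### Localization at `p` and at infinity. -/

section Local

variable {p : ℕ} [Fact p.Prime] {B : Type*} [Ring B] [Algebra ℚ B]

theorem localComponent_injective
    (φ : ℚ_[p] ⊗[ℚ] B ≃ₐ[ℚ_[p]] Matrix (Fin 2) (Fin 2) ℚ_[p]) :
    Function.Injective (localComponent φ) := by
  have h : Function.Injective (Algebra.TensorProduct.includeRight : B →ₐ[ℚ] ℚ_[p] ⊗[ℚ] B) :=
    Algebra.TensorProduct.includeRight_injective (algebraMap ℚ ℚ_[p]).injective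
  exact φ.injective.comp h

theorem padicMatrixIncl_injective (p : ℕ) [Fact p.Prime] :
    Function.Injective (padicMatrixIncl p) := by
  intro A A' h
  ext i j
  have := congrFun₂ h i j
  exact PadicInt.ext this

theorem exists_integral_localComponent {R : Subring B}
    (φ : ℚ_[p] ⊗[ℚ] B ≃ₐ[ℚ_[p]] Matrix (Fin 2) (Fin 2) ℚ_[p])
    (hφ : φ '' (localOrder p R : Set (ℚ_[p] ⊗[ℚ] B)) = Set.range (padicMatrixIncl p)) :
    ∃ l : R →+* Matrix (Fin 2) (Fin 2) ℤ_[p],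
      ∀ x : R, padicMatrixIncl p (l x) = localComponent φ x := by
  have h : ∀ x : R, ∃ A, padicMatrixIncl p A = localComponent φ x := by
    intro x
    have : φ ((1 : ℚ_[p]) ⊗ₜ[ℚ] (x : B)) ∈ Set.range (padicMatrixIncl p) := by
      rw [← hφ]
      exact ⟨_, Submodule.subset_span ⟨x, x.2, rfl⟩, rfl⟩
    exact this
  choose l hl using h
  have hinj := padicMatrixIncl_injective p
  exact ⟨{ toFun := l
           map_one' := hinj (by rw [hl]; simp)
           map_zero' := hinj (by rw [hl]; simp)
           map_mul' := fun x y => hinj (by rw [map_mul, hl, hl, hl]; simp)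
           map_add' := fun x y => hinj (by rw [map_add, hl, hl, hl]; simp) }, hl⟩

/-- Density: truncating `ℤ_p`-coefficients modulo `p` writes every element of `R_p` as an element of
`R` plus `p` times one of `R_p`. -/
theorem redMod_surjective {R : Subring B}
    (φ : ℚ_[p] ⊗[ℚ] B ≃ₐ[ℚ_[p]] Matrix (Fin 2) (Fin 2) ℚ_[p])
    (hφ : φ '' (localOrder p R : Set (ℚ_[p] ⊗[ℚ] B)) = Set.range (padicMatrixIncl p))
    (l : R →+* Matrix (Fin 2) (Fin 2) ℤ_[p])
    (hl : ∀ x : R, padicMatrixIncl p (l x) = localComponent φ x) :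
    Function.Surjective (redMod l) := by
  have key : ∀ v ∈ localOrder p R, ∃ x : R, ∃ v' ∈ localOrder p R,
      v = (1 : ℚ_[p]) ⊗ₜ[ℚ] (x : B) + (p : ℤ_[p]) • v' := by
    intro v hv
    induction hv using Submodule.span_induction with
    | mem v hv =>
      obtain ⟨x, hx, rfl⟩ := hv
      exact ⟨⟨x, hx⟩, 0, Submodule.zero_mem _, by simp⟩
    | zero => exact ⟨0, 0, Submodule.zero_mem _, by simp⟩
    | add v w _ _ hv hw =>
      obtain ⟨x, v', hv', rfl⟩ := hv
      obtain ⟨y, w', hw', rfl⟩ := hw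
      refine ⟨x + y, v' + w', Submodule.add_mem _ hv' hw', ?_⟩
      rw [Subring.coe_add, TensorProduct.tmul_add, smul_add]; abel
    | smul z v hvm hv =>
      obtain ⟨x, v', hv', hvv⟩ := hv
      obtain ⟨c, hc⟩ : (p : ℤ_[p]) ∣ z - z.zmodRepr := by
        have := (PadicInt.zmodRepr_spec z).2
        rwa [PadicInt.maximalIdeal_eq_span_p, Ideal.mem_span_singleton] at this
      refine ⟨z.zmodRepr * x, c • v + (z.zmodRepr : ℤ_[p]) • v',
        Submodule.add_mem _ (Submodule.smul_mem _ _ hvm) (Submodule.smul_mem _ _ hv'), ?_⟩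
      have hz : z = z.zmodRepr + p * c := by rw [← hc]; ring
      conv_lhs => rw [hz, add_smul, mul_smul]
      rw [smul_add (p : ℤ_[p])]
      have e : ((z.zmodRepr : ℕ) : ℤ_[p]) • v = (1 : ℚ_[p]) ⊗ₜ[ℚ] ((z.zmodRepr * x : R) : B)
          + (p : ℤ_[p]) • ((z.zmodRepr : ℤ_[p]) • v') := by
        conv_lhs => rw [hvv, smul_add]
        rw [smul_comm, Nat.cast_smul_eq_nsmul]
        congr 1
        rw [Subring.coe_mul, Subring.coe_natCast, ← nsmul_eq_mul, TensorProduct.tmul_smul]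
      rw [e]; abel
  intro A
  obtain ⟨A', rfl⟩ : ∃ A' : Matrix (Fin 2) (Fin 2) ℤ_[p],
      (PadicInt.toZMod (p := p)).mapMatrix A' = A :=
    ⟨fun i j => ((A i j).val : ℤ_[p]), by
      ext i j
      change PadicInt.toZMod (((A i j).val : ℕ) : ℤ_[p]) = A i j
      rw [map_natCast, ZMod.natCast_zmod_val]⟩
  have : padicMatrixIncl p A' ∈ φ '' (localOrder p R : Set (ℚ_[p] ⊗[ℚ] B)) := by
    rw [hφ]; exact ⟨A', rfl⟩
  obtain ⟨v, hv, hvA⟩ := this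
  obtain ⟨x, v', hv', rfl⟩ := key v hv
  obtain ⟨C, hC⟩ : φ v' ∈ Set.range (padicMatrixIncl p) := by
    rw [← hφ]; exact ⟨v', hv', rfl⟩
  refine ⟨x, ?_⟩
  have e : A' = l x + (p : ℤ_[p]) • C := by
    apply padicMatrixIncl_injective p
    rw [← hvA, map_add, map_add, hl]
    congr 1
    have h1 : (p : ℤ_[p]) • v' = (p : ℕ) • v' := Nat.cast_smul_eq_nsmul _ _ _
    have h2 : (p : ℤ_[p]) • C = (p : ℕ) • C := Nat.cast_smul_eq_nsmul _ _ _
    rw [h1, h2, map_nsmul, map_nsmul, hC]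
  rw [e, map_add]
  ext i j
  simp [redMod_apply]

/-- An element with scalar local component is central in `B`, hence rational, and it is integral. -/
theorem exists_intCast_of_scalar [Algebra.IsCentral ℚ B] {R : Subring B} (hR : IsQuatOrder R)
    (φ : ℚ_[p] ⊗[ℚ] B ≃ₐ[ℚ_[p]] Matrix (Fin 2) (Fin 2) ℚ_[p])
    (l : R →+* Matrix (Fin 2) (Fin 2) ℤ_[p])
    (hl : ∀ x : R, padicMatrixIncl p (l x) = localComponent φ x)
    (x : R) (z : ℤ_[p]) (hx : l x = z • 1) : ∃ n : ℤ, x = n := by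
  have hcent : (x : B) ∈ Subalgebra.center ℚ B := by
    rw [Subalgebra.mem_center_iff]
    intro b
    apply localComponent_injective φ
    have e : localComponent φ x = (z : ℚ_[p]) • 1 := by
      rw [← hl, hx]
      ext i j
      fin_cases i <;> fin_cases j <;> simp [padicMatrixIncl]
    rw [map_mul, map_mul, e, smul_mul_assoc, mul_smul_comm, one_mul, mul_one]
  obtain ⟨q, hq⟩ := (Algebra.IsCentral.mem_center_iff ℚ).1 hcent
  have : Module.Finite ℤ R := Module.Finite.iff_fg.2 hR.1
  have hint : IsIntegral ℤ x := (Algebra.IsIntegral.of_finite ℤ R).isIntegral x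
  have hint' : IsIntegral ℤ (x : B) := hint.map (R.subtype.toIntAlgHom)
  have : Nontrivial B := by
    refine ⟨⟨0, 1, fun h => ?_⟩⟩
    have := congrArg (localComponent φ) h
    rw [map_zero, map_one] at this
    exact zero_ne_one this
  rw [hq, isIntegral_algebraMap_iff (algebraMap ℚ B).injective, IsIntegrallyClosed.isIntegral_iff]
    at hint'
  obtain ⟨n, rfl⟩ := hint'
  exact ⟨n, Subtype.ext (by rw [hq]; simp)⟩

end Local

theorem exists_ringHom_real_matrix {B : Type*} [Ring B] [Algebra ℚ B]
    (hB : Nonempty (ℝ ⊗[ℚ] B ≃ₐ[ℝ] Matrix (Fin 2) (Fin 2) ℝ)) :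
    Nonempty (B →+* Matrix (Fin 2) (Fin 2) ℝ) :=
  let ⟨ψ⟩ := hB
  ⟨ψ.toAlgHom.toRingHom.comp
    (Algebra.TensorProduct.includeRight : B →ₐ[ℚ] ℝ ⊗[ℚ] B).toRingHom⟩

theorem orderOfConductor_mul_le {K : Type*} [Field K] [NumberField K] (p f : ℕ) :
    orderOfConductor K (p * f) ≤ orderOfConductor K f := by
  rintro _ ⟨a, y, rfl⟩
  exact ⟨a, p * y, by simp only [map_mul, map_natCast]; push_cast; ring⟩

/-! ### Conjugating the embedding by a unit. -/

theorem proposition1p3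
    (p : ℕ) [Fact p.Prime] (hp : p ≠ 2) (ε : ℤ) (hε : ¬ IsSquare (ε : ZMod p))
    (M : ℕ) (hpM : ¬ p ∣ M)
    -- `K` is an imaginary quadratic field in which `p` is inert
    (K : Type*) [Field K] [NumberField K] (hK : Module.finrank ℚ K = 2)
    (hKim : NumberField.IsTotallyComplex K) (hinert : (Ideal.span {(p : 𝓞 K)}).IsPrime)
    (f : ℕ) (hf : 0 < f) (hfN : Nat.Coprime f (p ^ 2 * M))
    -- `B` is an indefinite quaternion algebra over `ℚ`
    (B : Type*) [Ring B] [Algebra ℚ B] [Algebra.IsCentral ℚ B] [IsSimpleRing B]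
    (hB : Module.finrank ℚ B = 4)
    (hBindef : Nonempty (ℝ ⊗[ℚ] B ≃ₐ[ℝ] Matrix (Fin 2) (Fin 2) ℝ))
    -- `R` is an order of discriminant `M` into which `𝓞_f` embeds optimally
    (R : Subring B) (hR : IsQuatOrder R) (hRM : HasDiscriminant R M)
    (ι₀ : K →ₐ[ℚ] B) (hι₀ : IsOptimalEmbedding ι₀ (orderOfConductor K f) R)
    -- `B_p` is identified with `M₂(ℚ_p)` in such a way that `R_p` becomes `M₂(ℤ_p)`
    (φ : ℚ_[p] ⊗[ℚ] B ≃ₐ[ℚ_[p]] Matrix (Fin 2) (Fin 2) ℚ_[p])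
    (hφ : φ '' (localOrder p R : Set (ℚ_[p] ⊗[ℚ] B)) = Set.range (padicMatrixIncl p)) :
    ∃ ι : K →ₐ[ℚ] B,
      IsOptimalEmbedding ι (orderOfConductor K f) (levelOrder R φ (nonsplitCartan p ε)) ∧
      IsOptimalEmbedding ι (orderOfConductor K (p * f)) (levelOrder R φ (splitCartan p)) := by
  have hpf : ¬ p ∣ f := by
    have h : Nat.Coprime f p :=
      (Nat.Coprime.coprime_mul_right_right hfN).coprime_dvd_right (dvd_pow_self p two_ne_zero)
    exact (Nat.Prime.coprime_iff_not_dvd Fact.out).1 h.symm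
  obtain ⟨l, hl⟩ := exists_integral_localComponent φ hφ
  have hsurj := redMod_surjective φ hφ l hl
  have hscal := exists_intCast_of_scalar hR φ l hl
  obtain ⟨r⟩ := exists_ringHom_real_matrix hBindef
  have hmem : ∀ x : K, x ∈ orderOfConductor K f ↔ ι₀ x ∈ R := by
    intro x
    constructor
    · intro hx
      have : ι₀ x ∈ ι₀ '' (orderOfConductor K f : Set K) := ⟨x, hx, rfl⟩
      rw [← hι₀] at this
      exact this.2
    · intro hx
      have : ι₀ x ∈ Set.range ι₀ ∩ (R : Set B) := ⟨⟨x, rfl⟩, hx⟩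
      rw [hι₀] at this
      obtain ⟨y, hy, hyx⟩ := this
      rwa [← ι₀.toRingHom.injective hyx]
  let j : orderOfConductor K f →+* R :=
    (ι₀.toRingHom.comp (orderOfConductor K f).subtype).codRestrict R fun x => (hmem x).1 x.2
  obtain ⟨w, hw, htr⟩ := exists_map_trace_zero_nonsquare hp hK hinert hpf ((redMod l).comp j)
  obtain ⟨G, t, hG, ht, hconj⟩ := exists_conj_antidiagonal hp hε _ hw htr
  obtain ⟨g, hg⟩ : ∃ g : Rˣ, redMod l g = G := by
    obtain ⟨u, hu, d, hd, hud⟩ := exists_int_sq_neg_mem_orderOfConductor hK hKim hf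
    refine exists_unit_redMod_eq_of_indefinite hp hε l hsurj hscal (r.comp R.subtype)
      (w := j ⟨u, hu⟩) hd ?_ G hG
    rw [← map_mul, ← map_intCast j]
    congr 1
    exact Subtype.ext (by simpa using hud)
  have hgg : ((g : R) : B) * ((g⁻¹ : Rˣ) : R) = 1 := by
    exact_mod_cast congrArg (Subtype.val : R → B) g.mul_inv
  have hgg' : (((g⁻¹ : Rˣ) : R) : B) * (g : R) = 1 := by
    exact_mod_cast congrArg (Subtype.val : R → B) g.inv_mul
  let ι : K →ₐ[ℚ] B := RingHom.toRatAlgHom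
    { toFun := fun x => ((g⁻¹ : Rˣ) : R) * ι₀ x * (g : R)
      map_one' := by rw [map_one, mul_one, hgg']
      map_zero' := by rw [map_zero, mul_zero, zero_mul]
      map_mul' := fun x y => by
        calc _ = (((g⁻¹ : Rˣ) : R) : B) * ι₀ x * 1 * ι₀ y * (g : R) := by
              rw [map_mul, mul_one]; noncomm_ring
          _ = _ := by rw [← hgg]; noncomm_ring
      map_add' := fun x y => by rw [map_add, mul_add, add_mul] }
  have hι : ∀ x, ι x = ((g⁻¹ : Rˣ) : R) * ι₀ x * (g : R) := fun x => rfl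
  have hιmem : ∀ x, ι x ∈ R → x ∈ orderOfConductor K f := by
    intro x hx
    rw [hmem]
    have : ι₀ x = (g : R) * ι x * ((g⁻¹ : Rˣ) : R) := by
      calc ι₀ x = 1 * ι₀ x * 1 := by rw [one_mul, mul_one]
        _ = _ := by rw [← hgg, hι]; noncomm_ring
    rw [this]
    exact R.mul_mem (R.mul_mem (g : R).2 hx) ((g⁻¹ : Rˣ) : R).2
  obtain ⟨j', hj'def⟩ : ∃ j' : orderOfConductor K f → R,
      ∀ x, j' x = ((g⁻¹ : Rˣ) : R) * j x * (g : R) := ⟨_, fun _ => rfl⟩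
  have hj' : ∀ x, (j' x : B) = ι x := fun x => by rw [hj'def]; rfl
  have hred' : redMod l ((g⁻¹ : Rˣ) : R) * G = 1 := by
    rw [← hg, ← map_mul, Units.inv_mul, map_one]
  have hred : redMod l (g : R) * redMod l ((g⁻¹ : Rˣ) : R) = 1 := by
    rw [← map_mul, Units.mul_inv, map_one]
  have hT : redMod l (j' w) = !![0, t; (ε : ZMod p) * t, 0] := by
    have e : redMod l (j w) * G = G * !![0, t; (ε : ZMod p) * t, 0] := hconj
    simp only [hj'def]
    rw [map_mul, map_mul, hg, mul_assoc, e, ← mul_assoc, hred', one_mul]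
  -- The image of the order is commutative, so its reduction commutes with `(0, t; εt, 0)`, `t ≠ 0`.
  have hcomm : ∀ x, redMod l (j' x) 0 0 = redMod l (j' x) 1 1 ∧
      redMod l (j' x) 1 0 = redMod l (j' x) 0 1 * ε := by
    intro x
    have e : j' x * j' w = j' w * j' x := by
      apply Subtype.ext
      rw [Subring.coe_mul, Subring.coe_mul, hj', hj', ← map_mul, ← map_mul, mul_comm]
    have e := congrArg (redMod l) e
    rw [map_mul, map_mul, hT] at e
    have e00 := congrFun₂ e 0 0
    have e01 := congrFun₂ e 0 1
    simp [Matrix.mul_apply] at e00 e01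
    constructor
    · apply mul_right_cancel₀ ht; rw [e01]; ring
    · apply mul_right_cancel₀ ht; linear_combination -e00
  have hlevel : ∀ (L : Subring (Matrix (Fin 2) (Fin 2) ℤ_[p])) (x : R),
      (x : B) ∈ levelOrder R φ L ↔ l x ∈ L := by
    intro L x
    simp only [levelOrder, Subring.mem_inf, Subring.mem_comap, Subring.mem_map]
    constructor
    · rintro ⟨-, A, hA, hAx⟩
      rw [← hl] at hAx
      rwa [← padicMatrixIncl_injective p hAx]
    · exact fun h => ⟨x.2, l x, h, hl x⟩
  refine ⟨ι, ?_, ?_⟩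
  · apply Set.Subset.antisymm
    · rintro _ ⟨⟨x, rfl⟩, hx⟩
      exact ⟨x, hιmem x hx.1, rfl⟩
    · rintro _ ⟨x, hx, rfl⟩
      refine ⟨⟨x, rfl⟩, hj' ⟨x, hx⟩ ▸ (hlevel _ (j' ⟨x, hx⟩)).2 ?_⟩
      obtain ⟨h1, h2⟩ := hcomm ⟨x, hx⟩
      rw [redMod_apply, redMod_apply] at h1 h2
      constructor
      · rw [← toZMod_eq_zero_iff_dvd, map_sub, h1, sub_self]
      · rw [← toZMod_eq_zero_iff_dvd, map_sub, map_mul, map_intCast, h2, sub_self]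
  · apply Set.Subset.antisymm
    · rintro _ ⟨⟨x, rfl⟩, hx⟩
      have hxO := hιmem x hx.1
      obtain ⟨h1, h2⟩ := (hlevel _ (j' ⟨x, hxO⟩)).1 (hj' ⟨x, hxO⟩ ▸ hx)
      rw [← toZMod_eq_zero_iff_dvd, ← redMod_apply l] at h1 h2
      obtain ⟨h3, -⟩ := hcomm ⟨x, hxO⟩
      obtain ⟨a, ha⟩ := ZMod.intCast_surjective (redMod l (j' ⟨x, hxO⟩) 0 0)
      have hs : redMod l (j' ⟨x, hxO⟩) = a := by
        rw [intCast_fin_two]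
        ext i k
        fin_cases i <;> fin_cases k <;> simp [h1, h2, ← h3, ha]
      -- Scalars survive undoing the conjugation.
      have hs' : ((redMod l).comp j) ⟨x, hxO⟩ = a := by
        have e : j ⟨x, hxO⟩ = (g : R) * j' ⟨x, hxO⟩ * ((g⁻¹ : Rˣ) : R) := by
          simp only [hj'def]
          rw [← mul_assoc, ← mul_assoc, Units.mul_inv, one_mul, mul_assoc, Units.mul_inv, mul_one]
        rw [RingHom.comp_apply, e, map_mul, map_mul, hs, (Int.cast_commute a _).symm.eq, mul_assoc,
          hred, mul_one]
      exact ⟨x, mem_orderOfConductor_of_map_eq_intCast hinert hpf _ hs', rfl⟩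
    · rintro _ ⟨x, hx, rfl⟩
      have hxO := orderOfConductor_mul_le p f hx
      refine ⟨⟨x, rfl⟩, hj' ⟨x, hxO⟩ ▸ (hlevel _ (j' ⟨x, hxO⟩)).2 ?_⟩
      obtain ⟨a, y, hy⟩ := hx
      let Y : orderOfConductor K f := ⟨f * y, natCast_mul_mem_orderOfConductor f y⟩
      -- `x` is an integer plus `p` times an element of conductor `f`, so its off-diagonal entries
      -- are divisible by `p`.
      have e : j' ⟨x, hxO⟩ = (a : R) + (p : ℕ) * j' Y := by
        have e1 : (⟨x, hxO⟩ : orderOfConductor K f) = (a : ℤ) + (p : ℕ) * Y := by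
          apply Subtype.ext
          push_cast [Y]
          rw [hy]; push_cast; ring
        simp only [hj'def]
        rw [e1, map_add, map_mul, map_intCast, map_natCast, mul_add, add_mul,
          (Int.cast_commute a _).symm.eq, mul_assoc, Units.inv_mul, mul_one, ← mul_assoc,
          ← (Nat.cast_commute p _).eq]
        noncomm_ring
      have hla : l (j' ⟨x, hxO⟩) = !![(a : ℤ_[p]), 0; 0, a] + p • l (j' Y) := by
        rw [e, map_add, map_mul, map_intCast, map_natCast, intCast_fin_two, nsmul_eq_mul]
      constructor
      · rw [hla, Matrix.add_apply, Matrix.smul_apply, nsmul_eq_mul]; simp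
      · rw [hla, Matrix.add_apply, Matrix.smul_apply, nsmul_eq_mul]; simp
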